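/- **Definitions.** Let $\alpha_Z$ be the Z-shape: the bipartite shape with vertices $u_1,u_2,v_1,v_2$, distinguished tuples $U=(u_1,u_2)$, $V=(v_1,v_2)$ and edges $\{u_1,v_1\},\{u_2,v_1\},\{u_2,v_2\}$. For a natural number $q$, let $H(\alpha_Z,2q)$ be the multigraph on the $4q$ vertices $a_{i1},a_{i2},b_{i1},b_{i2}$ ($i\in\mathbb{Z}/q$; for $q=0$ the empty multigraph) obtained by gluing cyclically $q$ copies $(\alpha_Z)_i$ of $\alpha_Z$, on the vertices $a_{i1},a_{i2},b_{i1},b_{i2}$ with edges $\{a_{i1},b_{i1}\},\{a_{i2},b_{i1}\},\{a_{i2},b_{i2}\}$, and $q$ copies $(\alpha_Z^T)_i$ of its transpose, on the vertices $b_{i1},b_{i2},a_{(i+1)1},a_{(i+1)2}$ with edges $\{b_{i1},a_{(i+1)1}\},\{b_{i1},a_{(i+1)2}\},\{b_{i2},a_{(i+1)2}\}$; all $6q$ edges are kept, with multiplicity. A *constraint graph* $C$ on a multigraph $H$ is an equivalence class of forests on $V(H)$, where two forests are equivalent if they have the same connected components (as vertex sets); $|E(C)|$ is the number of edges of any forest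 in the class, and $u,v\in V(H)$ are *constrained together*, $u\longleftrightarrow v$, if they lie in the same component. Let $\mathcal{C}_{(\alpha_Z,2q)}$ be the set of constraint graphs on $H(\alpha_Z,2q)$ in which no two distinct vertices of the same copy of $\alpha_Z$ or of $\alpha_Z^T$ are constrained together. The *value* of $C$ is $\mathbb{E}_{G\sim G(W,1/2)}\big[\prod_{e\in E(H)}\chi_{\varphi(e)}(G)\big]$, where $\varphi:V(H)\to W$ is a map to a finite set $W$ with $\varphi(u)=\varphi(v)\iff u\longleftrightarrow v$ (the choice of $\varphi$ and $W$ does not matter), and $\chi_f(G)=1$ if $f\in E(G)$ and $\chi_f(G)=-1$ otherwise. A constraint graph $C\in\mathcal{C}_{(\alpha_Z,2q)}$ is *dominant* if it has nonzero value and $|E(C)|$ is minimal among all constraint graphs in $\mathcal{C}_{(\alpha_Z,2q)}$ with nonzero value. **Theorem.** For every natural number $q$, the number of dominant constraint graphs $C\in\mathcal{C}_{(\alpha_Z,2q)}$ is $$D_q=\frac{1}{2q+1}\binom{3q}{q}.$$ -/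

import Mathlib

namespace GraphMatrix

open SimpleGraph

/-! ## Constraint graphs on a vertex set -/

/-- In a finite forest, the number of edges plus the number of connected components is the number
of vertices. -/
theorem forest_card {V : Type*} [Finite V] (G : SimpleGraph V) (hG : G.IsAcyclic) :
    G.edgeSet.ncard + Nat.card G.ConnectedComponent = Nat.card V := by
  classical
  cases nonempty_fintype V
  have hV : Nat.card V = ∑ c : G.ConnectedComponent, Nat.card c.supp := by
    rw [← Nat.card_sigma]
    exact Nat.card_congr (Equiv.sigmaFiberEquiv G.connectedComponentMk).symm
  have htree : ∀ c : G.ConnectedComponent,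
      Nat.card c.toSimpleGraph.edgeSet + 1 = Nat.card c.supp := fun c =>
    ((isTree_iff_connected_and_card (G := c.toSimpleGraph)).1
      (hG.isTree_connectedComponent c)).2
  have hE : G.edgeSet.ncard = ∑ c : G.ConnectedComponent, Nat.card c.toSimpleGraph.edgeSet := by
    rw [← Nat.card_sigma, ← Nat.card_coe_set_eq]
    refine (Nat.card_congr (Equiv.ofBijective
      (fun p : (c : G.ConnectedComponent) × c.toSimpleGraph.edgeSet =>
        (p.1.toSimpleGraph_hom.mapEdgeSet p.2 : G.edgeSet)) ⟨?_, ?_⟩)).symm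
    · rintro ⟨c, ⟨e, he⟩⟩ ⟨d, ⟨f, hf⟩⟩ h
      induction e using Sym2.ind with | _ a b =>
      induction f using Sym2.ind with | _ a' b' =>
      have h' : s((a : V), (b : V)) = s((a' : V), (b' : V)) := congrArg Subtype.val h
      obtain ⟨a, ha⟩ := a
      obtain ⟨b, hb⟩ := b
      obtain ⟨a', ha'⟩ := a'
      obtain ⟨b', hb'⟩ := b'
      rcases Sym2.eq_iff.1 h' with ⟨h1, h2⟩ | ⟨h1, h2⟩
      · simp only at h1 h2
        subst h1 h2
        obtain rfl : c = d := (show G.connectedComponentMk a = c from ha).symm.trans ha'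
        rfl
      · simp only at h1 h2
        subst h1 h2
        obtain rfl : c = d := (show G.connectedComponentMk a = c from ha).symm.trans hb'
        congr 2
        exact Sym2.eq_swap
    · rintro ⟨e, he⟩
      induction e using Sym2.ind with | _ a b =>
      have hab : G.Adj a b := he
      exact ⟨⟨G.connectedComponentMk a, ⟨s(⟨a, rfl⟩, ⟨b, (ConnectedComponent.sound
        hab.symm.reachable)⟩), hab⟩⟩, rfl⟩
  rw [hE, hV, Nat.card_eq_fintype_card, Fintype.card_eq_sum_ones, ← Finset.sum_add_distrib]
  exact Finset.sum_congr rfl fun c _ => htree c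

/-- Two forests on the same vertex set are equivalent when they connect the same pairs of
vertices. -/
def forestSetoid (V : Type*) : Setoid {G : SimpleGraph V // G.IsAcyclic} where
  r G G' := ∀ u v, G.1.Reachable u v ↔ G'.1.Reachable u v
  iseqv := ⟨fun _ _ _ => Iff.rfl, fun h u v => (h u v).symm, fun h h' u v => (h u v).trans (h' u v)⟩

/-- A constraint graph on the vertex set `V`: an equivalence class of forests on `V` (whose edges
are the constraint edges), two forests being equivalent when they connect the same pairs of
vertices. -/
def ConstraintGraph (V : Type*) : Type _ := Quotient (forestSetoid V)

namespace ConstraintGraph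

variable {V : Type*}

/-- `C.Constrained u v` (written `u ⟷ v`): `u` and `v` are joined by a path of constraint edges
in the representatives of `C`. -/
def Constrained (C : ConstraintGraph V) (u v : V) : Prop :=
  Quotient.lift (fun G : {G : SimpleGraph V // G.IsAcyclic} => G.1.Reachable u v)
    (fun G G' (h : ∀ u v, G.1.Reachable u v ↔ G'.1.Reachable u v) => propext (h u v)) C

/-- Being constrained together is an equivalence relation. -/
def setoid (C : ConstraintGraph V) : Setoid V where
  r := C.Constrained
  iseqv := by
    induction C using Quotient.ind with | _ G =>
    exact G.1.reachable_is_equivalence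

/-- `|E(C)|`: the number of edges of any representative forest of `C`. -/
noncomputable def numEdges [Finite V] (C : ConstraintGraph V) : ℕ :=
  Quotient.lift (fun G : {G : SimpleGraph V // G.IsAcyclic} => G.1.edgeSet.ncard)
    (fun G G' (h : ∀ u v, G.1.Reachable u v ↔ G'.1.Reachable u v) => by
      have h1 := forest_card G.1 G.2
      have h2 := forest_card G'.1 G'.2
      have h3 : Nat.card G.1.ConnectedComponent = Nat.card G'.1.ConnectedComponent :=
        Nat.card_congr (Quot.congrRight h)
      change G.1.edgeSet.ncard = G'.1.edgeSet.ncard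
      omega) C

end ConstraintGraph

/-! ## Multigraphs, contraction and the value of a constraint graph -/

/-- A multigraph with vertex set `V` and edges labelled by `E`. -/
structure Multigraph (V E : Type*) where
  /-- the pair of endpoints of an edge -/
  ends : E → Sym2 V

/-- `H / C`: contract all constraint edges, keeping every edge of `H` (with multiplicity). -/
def Multigraph.contract {V E : Type*} (H : Multigraph V E) (C : ConstraintGraph V) :
    Multigraph (Quotient C.setoid) E where
  ends e := (H.ends e).map (Quotient.mk C.setoid)

open Classical in
/-- The Fourier character `χ_e(G)`: `1` if `e` is an edge of `G` and `-1` otherwise. -/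
noncomputable def edgeChar {W : Type*} (G : SimpleGraph W) (e : Sym2 W) : ℝ :=
  if e ∈ G.edgeSet then 1 else -1

/-- The value of a constraint graph `C` on `H`: the expectation, over `G ∼ G(W, 1/2)`, of the
product of `χ_{φ(e)}(G)` over all edges `e` of `H`, where `φ` is a map to the vertex set `W` with
`φ u = φ v` exactly when `u ⟷ v` in `C`. The expectation only depends on the image of `φ`, so we
take for `φ` the projection to the vertices of `H / C`. -/
noncomputable def ConstraintGraph.value {V E : Type*} [Fintype E] (H : Multigraph V E)
    (C : ConstraintGraph V) : ℝ :=
  ∫ G, ∏ e : E, edgeChar G ((H.contract C).ends e)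
    ∂SimpleGraph.binomialRandom (Quotient C.setoid) ⟨1 / 2, by norm_num, by norm_num⟩

/-! ## Bipartite shapes and the multigraph `H(α, 2q)` -/

/-- A bipartite shape: vertices `u₁, …, u_k` and `v₁, …, v_l`, distinguished tuples
`(u₁, …, u_k)` and `(v₁, …, v_l)`, and all edges of the form `{u_x, v_y}` (recorded as `(x, y)`). -/
structure BipartiteShape where
  /-- number of left vertices -/
  k : ℕ
  /-- number of right vertices -/
  l : ℕ
  /-- the edges -/
  edges : Finset (Fin k × Fin l)

namespace BipartiteShape

variable (α : BipartiteShape) (q : ℕ)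

/-- The vertices of `H(α, 2q)`: `Sum.inl (i, x)` is `a_{ix}` and `Sum.inr (i, y)` is `b_{iy}`. -/
abbrev CycleVertex : Type := (Fin q × Fin α.k) ⊕ (Fin q × Fin α.l)

/-- The edges of `H(α, 2q)`: one for each edge of each of the `q` copies of `α` (`false`) and of
the `q` copies of `αᵀ` (`true`). -/
abbrev CycleEdge : Type := Fin q × Bool × α.edges

/-- `H(α, 2q)`: the copies `α₁, α₁ᵀ, α₂, α₂ᵀ, …, α_q, α_qᵀ` glued cyclically. The copy `α_i` has
vertices `a_{ix}` and `b_{iy}`; the copy `α_iᵀ` has vertices `b_{iy}` and `a_{(i+1)x}`, where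
`i + 1` is taken cyclically. -/
def cycleGraph : Multigraph (α.CycleVertex q) (α.CycleEdge q) where
  ends
    | (i, false, e) => s(Sum.inl (i, e.1.1), Sum.inr (i, e.1.2))
    | (i, true, e) => s(Sum.inr (i, e.1.2), Sum.inl (finRotate q i, e.1.1))

/-- The set of vertices of the copy `α_i` (`false`), respectively `α_iᵀ` (`true`). -/
def piece (i : Fin q) : Bool → Set (α.CycleVertex q)
  | false => {w | (∃ x, w = Sum.inl (i, x)) ∨ ∃ y, w = Sum.inr (i, y)}
  | true => {w | (∃ y, w = Sum.inr (i, y)) ∨ ∃ x, w = Sum.inl (finRotate q i, x)}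

/-- `𝒞_{(α, 2q)}`: the constraint graphs on `H(α, 2q)` which do not constrain together two distinct
vertices of one copy of `α` or of `αᵀ`. -/
def constraintGraphs : Set (ConstraintGraph (α.CycleVertex q)) :=
  {C | ∀ i b, ∀ u ∈ α.piece q i b, ∀ v ∈ α.piece q i b, C.Constrained u v → u = v}

/-- `C` is dominant: it belongs to `𝒞_{(α, 2q)}`, has nonzero value, and has the least number of
edges among the nonzero-valued members of `𝒞_{(α, 2q)}`. -/
def IsDominant (C : ConstraintGraph (α.CycleVertex q)) : Prop :=
  C ∈ α.constraintGraphs q ∧ C.value (α.cycleGraph q) ≠ 0 ∧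
    ∀ C' ∈ α.constraintGraphs q, C'.value (α.cycleGraph q) ≠ 0 → C.numEdges ≤ C'.numEdges

end BipartiteShape

/-- The Z-shape, with edges `{u₁, v₁}`, `{u₂, v₁}` and `{u₂, v₂}`. -/
def zShape : BipartiteShape where
  k := 2
  l := 2
  edges := {(0, 0), (1, 0), (1, 1)}

end GraphMatrix

namespace GraphMatrix

open SimpleGraph

/-! ### Constraint graphs as equivalence relations, and when their value vanishes. -/

namespace ConstraintGraph

variable {V : Type*}

/-! Write x_i, y_i, z_i, w_i for the images of a_{i1}, b_{i1}, a_{i2}, b_{i2} in the contraction by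
`C`. The value of `C` is nonzero exactly when every edge of the contraction has even multiplicity
(`ConstraintGraph.value_ne_zero_iff`), and few constraint edges mean many vertices. The edges are
the steps of two closed walks x_0 y_0 x_1 y_1 … and z_0 w_0 z_1 w_1 … of length 2q, together with
the cross edges z_i y_i and y_i z_{i+1}.

There are at most 2q + 2 vertices. If a cross edge coincides with a step of a walk, then counting
first entrances and last departures gives strictly fewer (`card_lt_of_step_eq_cross`). Otherwise the
steps and the cross edges are even separately. A connected graph with k edges has at most k + 1
vertices, so 2q + 2 is reached only by two disjoint walks, each going round a tree with q edges and
traversing every edge twice (`card_union_of_even_steps`).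

Such a walk is encoded by the partition of its even positions: this partition is noncrossing, and
the odd positions carry its Kreweras complement (`IsTreeWalk.noncrossing`, `IsTreeWalk.odd_eq_iff`).
Given this, evenness of the cross edges says that the partition P of the x_i refines the partition σ
of the z_i (`IsTreeWalk.eq_of_even_cross`, and `value_ne_zero_of_pair` for the converse). Dominant
constraint graphs therefore correspond to pairs P ≤ σ of noncrossing partitions of q points.

Cutting a pair at the next member of the class of the first point, once for P and then once for σ,
leaves three smaller pairs. The count thus obeys the recursion of ternary trees, its generating
function satisfies B = 1 + X B³, and the coefficients of B follow (`ternaryCount_formula`). -/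

theorem ext_constrained {C D : ConstraintGraph V}
    (h : ∀ u v, C.Constrained u v ↔ D.Constrained u v) : C = D := by
  induction C using Quotient.ind with | _ G =>
  induction D using Quotient.ind with | _ G' =>
  exact Quotient.sound h

/-- A spanning forest of the graph that joins all related pairs represents `r`. -/
theorem exists_constrained_iff (r : Setoid V) :
    ∃ C : ConstraintGraph V, ∀ u v, C.Constrained u v ↔ r u v := by
  let G : SimpleGraph V :=
    { Adj := fun u v => u ≠ v ∧ r u v
      symm := ⟨fun u v h => ⟨h.1.symm, r.symm h.2⟩⟩
      loopless := ⟨fun u h => h.1 rfl⟩ }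
  have hG : ∀ u v, G.Reachable u v ↔ r u v := by
    intro u v
    constructor
    · rintro ⟨p⟩
      induction p with
      | nil => exact r.refl _
      | cons h _ ih => exact r.trans h.2 ih
    · intro h
      by_cases huv : u = v
      · subst huv
        exact Reachable.refl _
      · exact Adj.reachable (show G.Adj u v from ⟨huv, h⟩)
  obtain ⟨F, -, hF⟩ := G.exists_maximal_isAcyclic_of_le_isAcyclic (H := ⊥) bot_le isAcyclic_bot
  refine ⟨Quotient.mk _ ⟨F, hF.prop.2⟩, fun u v => ?_⟩
  rw [← hG, ← G.reachable_eq_of_maximal_isAcyclic F hF]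
  rfl

/-- Minimising the edges is maximising the vertices of the contraction; the counting below uses the
latter. -/
theorem numEdges_add_card [Finite V] (C : ConstraintGraph V) :
    C.numEdges + Nat.card (Quotient C.setoid) = Nat.card V := by
  induction C using Quotient.ind with | _ G =>
  exact forest_card G.1 G.2

theorem constrained_iff {C : ConstraintGraph V} {u v : V} :
    C.Constrained u v ↔ Quotient.mk C.setoid u = Quotient.mk C.setoid v :=
  (Quotient.eq (r := C.setoid)).symm

end ConstraintGraph

theorem edgeChar_mul_self {W : Type*} (G : SimpleGraph W) (e : Sym2 W) :
    edgeChar G e * edgeChar G e = 1 := by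
  unfold edgeChar
  split_ifs <;> norm_num

/-- Add the edge `e` if it is absent, and delete it if it is present. -/
def toggleEdge {W : Type*} (e : Sym2 W) (G : SimpleGraph W) : SimpleGraph W :=
  SimpleGraph.fromEdgeSet (symmDiff G.edgeSet {e})

theorem edgeSet_toggleEdge {W : Type*} {e : Sym2 W} (he : ¬ e.IsDiag) (G : SimpleGraph W) :
    (toggleEdge e G).edgeSet = symmDiff G.edgeSet {e} := by
  rw [toggleEdge, edgeSet_fromEdgeSet, sdiff_eq_left, Set.disjoint_left]
  intro f hf hd
  rcases hf with ⟨hf, -⟩ | ⟨hf, -⟩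
  · exact G.not_isDiag_of_mem_edgeSet hf hd
  · rw [Set.mem_singleton_iff] at hf
    exact he (hf ▸ hd)

theorem toggleEdge_involutive {W : Type*} {e : Sym2 W} (he : ¬ e.IsDiag) :
    Function.Involutive (toggleEdge e) := by
  intro G
  apply edgeSet_injective
  rw [edgeSet_toggleEdge he, edgeSet_toggleEdge he, symmDiff_symmDiff_cancel_right]

theorem edgeChar_toggleEdge {W : Type*} [DecidableEq (Sym2 W)] {e : Sym2 W} (he : ¬ e.IsDiag)
    (G : SimpleGraph W) (f : Sym2 W) :
    edgeChar (toggleEdge e G) f = (if f = e then -1 else 1) * edgeChar G f := by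
  have key : f ∈ (toggleEdge e G).edgeSet ↔ (f ∈ G.edgeSet ∧ f ≠ e) ∨ (f = e ∧ f ∉ G.edgeSet) := by
    rw [edgeSet_toggleEdge he, Set.mem_symmDiff, Set.mem_singleton_iff]
  unfold edgeChar
  by_cases hfe : f = e
  · subst hfe
    by_cases hf : f ∈ G.edgeSet
    · rw [if_neg (by simp [key, hf]), if_pos hf]
      simp
    · rw [if_pos (by simp [key, hf]), if_neg hf]
      simp
  · by_cases hf : f ∈ G.edgeSet
    · rw [if_pos (by simp [key, hf, hfe]), if_pos hf]
      simp [hfe]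
    · rw [if_neg (by simp [key, hf, hfe]), if_neg hf]
      simp [hfe]

-- If `f` has odd multiplicity, toggling `f` preserves G(W, 1/2) and changes the sign of the
-- product, so the expectation vanishes. If all multiplicities are even, the product is identically
-- 1.
open Classical in
theorem ConstraintGraph.value_ne_zero_iff {V E : Type*} [Finite V] [Fintype E] (H : Multigraph V E)
    (C : ConstraintGraph V) (hloop : ∀ e, ¬ ((H.contract C).ends e).IsDiag) :
    C.value H ≠ 0 ↔ ∀ f, Even (Finset.univ.filter fun e => (H.contract C).ends e = f).card := by
  set W := Quotient C.setoid
  have : Finite W := Quotient.finite _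
  cases nonempty_fintype W
  have hfin : Finite (SimpleGraph W) := inferInstance
  cases nonempty_fintype (SimpleGraph W)
  constructor
  · intro hv f
    by_contra hodd
    rw [Nat.not_even_iff_odd] at hodd
    -- The absence of loops matters here: only a genuine edge can be toggled.
    have hf : ¬ f.IsDiag := by
      obtain ⟨e, he⟩ := Finset.card_pos.1 hodd.pos
      rw [Finset.mem_filter] at he
      exact he.2 ▸ hloop e
    apply hv
    have hmeas : MeasurableSingletonClass (SimpleGraph W) := ⟨fun G => by
      rw [← measurableEmbedding_edgeSet.measurableSet_image, Set.image_singleton]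
      exact measurableSet_singleton _⟩
    have hint : ∀ g : SimpleGraph W → ℝ, MeasureTheory.Integrable g
        (SimpleGraph.binomialRandom W ⟨1 / 2, by norm_num, by norm_num⟩) :=
      fun g => MeasureTheory.Integrable.of_finite
    -- At density 1/2 all graphs have the same weight, so the integral is a multiple of a plain sum.
    have hconst : ∃ c : ℝ, ∀ G : SimpleGraph W,
        (SimpleGraph.binomialRandom W ⟨1 / 2, by norm_num, by norm_num⟩).real {G} = c := by
      refine ⟨(1 / 2 : ℝ) ^ ((Nat.card W).choose 2), fun G => ?_⟩
      have hle : G.edgeSet.ncard ≤ (Nat.card W).choose 2 := by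
        have h := G.card_edgeFinset_le_card_choose_two
        rwa [← Set.ncard_coe_finset, coe_edgeFinset, ← Nat.card_eq_fintype_card] at h
      rw [MeasureTheory.measureReal_def, binomialRandom_singleton]
      simp only [ENNReal.toReal_mul, ENNReal.toReal_pow, ENNReal.coe_toReal,
        unitInterval.coe_toNNReal, unitInterval.coe_symm_eq]
      rw [show (1 - 1 / 2 : ℝ) = 1 / 2 by norm_num, ← pow_add, Nat.add_sub_cancel' hle]
    obtain ⟨c, hc⟩ := hconst
    unfold ConstraintGraph.value
    rw [MeasureTheory.integral_fintype (hint _)]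
    have hflip : ∀ G : SimpleGraph W,
        ∏ e, edgeChar (toggleEdge f G) ((H.contract C).ends e) =
          - ∏ e, edgeChar G ((H.contract C).ends e) := by
      intro G
      simp_rw [edgeChar_toggleEdge hf]
      rw [Finset.prod_mul_distrib, Finset.prod_ite, Finset.prod_const, Finset.prod_const_one,
        hodd.neg_one_pow]
      ring
    have hsum := Equiv.sum_comp (toggleEdge_involutive hf).toPerm
      (fun G => c • ∏ e, edgeChar G ((H.contract C).ends e))
    simp only [Function.Involutive.coe_toPerm, hflip, smul_neg, Finset.sum_neg_distrib] at hsum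
    simp only [hc]
    linarith
  · intro h
    have hone : ∀ G : SimpleGraph W, ∏ e, edgeChar G ((H.contract C).ends e) = 1 := by
      intro G
      rw [← Finset.prod_fiberwise (s := Finset.univ) (g := fun e => (H.contract C).ends e)]
      refine Finset.prod_eq_one fun f _ => ?_
      rw [Finset.prod_congr rfl (g := fun _ => edgeChar G f)
        (fun e he => by rw [(Finset.mem_filter.1 he).2]), Finset.prod_const]
      obtain ⟨k, hk⟩ := h f
      rw [hk, ← two_mul, pow_mul, pow_two, edgeChar_mul_self, one_pow]
    unfold ConstraintGraph.value
    simp only [hone]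
    simp

/-! ### Two interleaved walkers: a strict bound when a step coincides with a cross edge. -/

/-- Position from which the `n`-th step of the interleaved pair of walks starts. -/
def stepSource (n : ℕ) : ℕ := if Even n then n - 1 else n - 3

/-- Here `u n` is the vertex entered at step `n`, and before step `c + 1` the walkers stand at `u c`
and `u (c - 2)`. Every other vertex has a first entrance and a last departure among the 4q steps,
and no step is both, since its edge would then occur exactly once. So the other vertices number at
most half the steps; the step in `hcoin` is of neither sort, which makes the bound strict. -/
theorem card_lt_of_step_eq_cross {β : Type*} [Fintype β] [DecidableEq β] (u : ℕ → β) {q c : ℕ}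
    (hc : Even c) (hc4 : 4 ≤ c)
    (hsurj : ∀ b, ∃ n ∈ Finset.Ioc c (c + 4 * q), u n = b)
    (hend : u (c + 4 * q) = u c) (hend' : u (c + 4 * q - 2) = u (c - 2))
    (hdist : ∀ n, Even n → u n ≠ u (n + 1))
    (heven : ∀ e, Even (((Finset.Ioc c (c + 4 * q)).filter
        fun n => s(u (stepSource n), u n) = e).card +
      ((Finset.Ioc c (c + 4 * q)).filter fun n => Even n ∧ s(u (n - 2), u n) = e).card))
    (hcoin : ∃ n ∈ Finset.Ioc c (c + 4 * q), s(u (stepSource n), u n) = s(u (c - 2), u c)) :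
    Fintype.card β < 2 * q + 2 := by
  classical
  set I := Finset.Ioc c (c + 4 * q) with hI
  set N : Finset β := Finset.univ \ {u c, u (c - 2)} with hN
  have hNmem : ∀ b ∈ N, b ≠ u c ∧ b ≠ u (c - 2) := fun b hb => by simpa [hN] using hb
  have hF : ∀ b : β, ∃ n ∈ I, u n = b ∧ ∀ m ∈ I, u m = b → n ≤ m := fun b => by
    obtain ⟨n, hn, hnb⟩ := hsurj b
    obtain ⟨a, ha, hmin⟩ := Finset.exists_min_image (I.filter fun n => u n = b) id
      ⟨n, Finset.mem_filter.2 ⟨hn, hnb⟩⟩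
    rw [Finset.mem_filter] at ha
    exact ⟨a, ha.1, ha.2, fun m hm hmb => hmin m (Finset.mem_filter.2 ⟨hm, hmb⟩)⟩
  have hM : ∀ b : β, ∃ n ∈ I, u n = b ∧ ∀ m ∈ I, u m = b → m ≤ n := fun b => by
    obtain ⟨n, hn, hnb⟩ := hsurj b
    obtain ⟨a, ha, hmax⟩ := Finset.exists_max_image (I.filter fun n => u n = b) id
      ⟨n, Finset.mem_filter.2 ⟨hn, hnb⟩⟩
    rw [Finset.mem_filter] at ha
    exact ⟨a, ha.1, ha.2, fun m hm hmb => hmax m (Finset.mem_filter.2 ⟨hm, hmb⟩)⟩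
  choose F hFI hFu hFmin using hF
  choose M hMI hMu hMmax using hM
  obtain ⟨n₀, hn₀, hn₀e⟩ := hcoin
  -- The step that leaves position `m`, a right inverse of `stepSource`; `succ (M b)` is the last
  -- departure from `b`.
  set succ : ℕ → ℕ := fun m => if Even m then m + 3 else m + 1 with hsucc
  have hsrc : ∀ m, stepSource (succ m) = m := fun m => by
    simp only [hsucc, stepSource]
    by_cases hm : Even m
    · rw [if_pos hm, if_neg (by grind)]
      omega
    · rw [if_neg hm, if_pos (by grind)]
      omega
  have hmem : ∀ m, m ∈ I ↔ c < m ∧ m ≤ c + 4 * q := fun m => Finset.mem_Ioc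
  -- Both walkers end where they started, so no vertex of `N` is a final position and its last
  -- departure stays in the window.
  have hMlt : ∀ b ∈ N, M b ≤ c + 4 * q - 1 ∧ M b ≠ c + 4 * q - 2 := by
    intro b hb
    have h1 : M b ≠ c + 4 * q := fun h => (hNmem b hb).1 (by rw [← hMu b, h, hend])
    have h2 : M b ≠ c + 4 * q - 2 := fun h => (hNmem b hb).2 (by rw [← hMu b, h, hend'])
    have := (hmem _).1 (hMI b)
    omega
  have hLI : ∀ b ∈ N, succ (M b) ∈ I := by
    intro b hb
    have h1 := hMlt b hb
    have h2 := (hmem _).1 (hMI b)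
    rw [hmem]
    simp only [hsucc]
    obtain ⟨k, hk⟩ := hc
    split_ifs with h
    · obtain ⟨l, hl⟩ := h
      omega
    · omega
  have hFinj : Set.InjOn F N := fun a _ b _ h => by rw [← hFu a, ← hFu b, h]
  have hLinj : Set.InjOn (fun b => succ (M b)) N := fun a _ b _ h => by
    have h' := congrArg stepSource h
    simp only [hsrc] at h'
    rw [← hMu a, ← hMu b, h']
  -- If the first entrance into `b` were the last departure from `g`, the edge `s(g, b)` would occur
  -- once among the steps and never among the cross edges, against `heven`.
  have hdisj : Disjoint (N.image F) (N.image fun b => succ (M b)) := by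
    rw [Finset.disjoint_left]
    intro n hnF hnL
    obtain ⟨b, hb, rfl⟩ := Finset.mem_image.1 hnF
    obtain ⟨g, hg, hgb⟩ := Finset.mem_image.1 hnL
    have hgb' : M g = stepSource (F b) := by rw [← hgb, hsrc]
    have hMF : (Even (F b) ∧ M g = F b - 1) ∨ (¬ Even (F b) ∧ M g = F b - 3) := by
      rw [hgb', stepSource]
      split_ifs with h <;> simp [h]
    have hb1 := (hmem _).1 (hFI b)
    have hg1 := (hmem _).1 (hMI g)
    -- positions outside the window carry an initial block
    have hwin : ∀ n ∈ I, ∀ a ∈ N, u (stepSource n) = a → stepSource n ∈ I := by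
      intro n hn a ha h
      rw [hmem] at hn ⊢
      have h1 : stepSource n ≠ c := fun h' => (hNmem a ha).1 (by rw [← h, h'])
      have h2 : stepSource n ≠ c - 2 := fun h' => (hNmem a ha).2 (by rw [← h, h'])
      obtain ⟨k, hk⟩ := hc
      by_cases he : Even n
      · have h3 : stepSource n = n - 1 := if_pos he
        obtain ⟨l, hl⟩ := he
        omega
      · have h3 : stepSource n = n - 3 := if_neg he
        rw [Nat.not_even_iff_odd] at he
        obtain ⟨l, hl⟩ := he
        omega
    have hS : (I.filter fun n => s(u (stepSource n), u n) = s(g, b)) = {F b} := by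
      ext n
      rw [Finset.mem_filter, Finset.mem_singleton]
      constructor
      · rintro ⟨hn, he⟩
        rcases Sym2.eq_iff.1 he with ⟨h1, h2⟩ | ⟨h1, h2⟩
        · have h3 := hFmin b n hn h2
          have h4 := hMmax g _ (hwin n hn g hg h1) h1
          by_contra hne
          rcases hMF with ⟨h5, h6⟩ | ⟨h5, h6⟩
          -- The inequalities leave only `F b` and `F b + 1`; the latter is excluded since these
          -- positions carry different vertices.
          · have h7 : n ≠ F b + 1 := fun h => hdist _ h5 (by rw [← h, h2, hFu])
            unfold stepSource at h4
            split_ifs at h4 with h8 <;> rw [Nat.even_iff] at h5 h8 <;> omega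
          · have h7 : n ≠ F b + 1 := fun h => by
              have : Even n := by rw [h]; exact Nat.even_add_one.2 h5
              rw [stepSource, if_pos this] at h4
              omega
            unfold stepSource at h4
            split_ifs at h4 with h8 <;> omega
        · have h3 := hFmin b _ (hwin n hn b hb h1) h1
          have h4 := hMmax g n hn h2
          unfold stepSource at h3
          split_ifs at h3 <;> omega
      · rintro rfl
        refine ⟨hFI b, ?_⟩
        rw [← hgb', hMu, hFu]
    have hK : (I.filter fun n => Even n ∧ s(u (n - 2), u n) = s(g, b)) = ∅ := by
      rw [Finset.filter_eq_empty_iff]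
      rintro n hn ⟨hne, he⟩
      have hnI := (hmem _).1 hn
      have hwin2 : ∀ a ∈ N, u (n - 2) = a → n - 2 ∈ I := by
        intro a ha h
        have h1 : n - 2 ≠ c := fun h' => (hNmem a ha).1 (by rw [← h, h'])
        rw [hmem]
        obtain ⟨k, hk⟩ := hc
        obtain ⟨l, hl⟩ := hne
        omega
      rcases Sym2.eq_iff.1 he with ⟨h1, h2⟩ | ⟨h1, h2⟩
      · have h3 := hFmin b n hn h2
        have h4 := hMmax g _ (hwin2 g hg h1) h1
        rcases hMF with ⟨h5, h6⟩ | ⟨h5, h6⟩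
        · have h7 : n = F b := by
            obtain ⟨l, hl⟩ := hne
            obtain ⟨k, hk⟩ := h5
            omega
          -- Now `g` would occupy both positions `n - 2` and `n - 1 = M g`, which `hdist` forbids.
          have h8 : Even (n - 2) := by
            obtain ⟨l, hl⟩ := hne
            exact ⟨l - 1, by omega⟩
          apply hdist _ h8
          rw [h1, show n - 2 + 1 = M g by omega, hMu]
        · omega
      · have h3 := hFmin b _ (hwin2 b hb h1) h1
        have h4 := hMmax g n hn h2
        omega
    have := heven s(g, b)
    rw [hS, hK] at this
    simp at this
  -- Step `n₀` joins the two starting vertices, so it neither enters nor leaves a vertex of `N`.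
  have hsub : N.image F ∪ N.image (fun b => succ (M b)) ⊆ I.erase n₀ := by
    intro n hn
    rw [Finset.mem_erase]
    rcases Finset.mem_union.1 hn with h | h
    · obtain ⟨b, hb, rfl⟩ := Finset.mem_image.1 h
      refine ⟨fun h' => ?_, hFI b⟩
      rw [← h', hFu] at hn₀e
      have := hNmem b hb
      rcases Sym2.eq_iff.1 hn₀e with ⟨h1, h2⟩ | ⟨h1, h2⟩
      · exact this.1 h2
      · exact this.2 h2
    · obtain ⟨b, hb, rfl⟩ := Finset.mem_image.1 h
      refine ⟨fun h' => ?_, hLI b hb⟩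
      rw [← h', hsrc, hMu] at hn₀e
      have := hNmem b hb
      rcases Sym2.eq_iff.1 hn₀e with ⟨h1, h2⟩ | ⟨h1, h2⟩
      · exact this.2 h1
      · exact this.1 h1
  have hcard := Finset.card_le_card hsub
  rw [Finset.card_union_of_disjoint hdisj, Finset.card_image_of_injOn hFinj,
    Finset.card_image_of_injOn hLinj, Finset.card_erase_of_mem hn₀, hI, Nat.card_Ioc] at hcard
  have hI0 := (hmem _).1 hn₀
  have hNc : Fintype.card β ≤ N.card + 2 := by
    have h1 := Finset.le_card_sdiff {u c, u (c - 2)} (Finset.univ : Finset β)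
    have h2 : ({u c, u (c - 2)} : Finset β).card ≤ 2 := Finset.card_le_two
    rw [Finset.card_univ, ← hN] at h1
    omega
  omega

/-! ### Connected graphs and closed walks with even multiplicities. -/

/-- Send each vertex other than `r` to an edge towards a neighbour closer to `r`; comparing
distances shows injectivity. -/
theorem card_le_card_add_one_of_reachable {β : Type*} (E : Finset (Sym2 β)) (B : Finset β) (r : β)
    (h : ∀ b ∈ B, (fromEdgeSet (E : Set (Sym2 β))).Reachable b r) : B.card ≤ E.card + 1 := by
  classical
  set G := fromEdgeSet (E : Set (Sym2 β)) with hG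
  have hpar : ∀ b ∈ B.erase r, ∃ b', G.Adj b b' ∧ G.dist b' r < G.dist b r := by
    intro b hb
    rw [Finset.mem_erase] at hb
    obtain ⟨p, hp⟩ := (h b hb.2).exists_walk_length_eq_dist
    cases p with
    | nil => exact absurd rfl hb.1
    | cons hadj p' =>
      refine ⟨_, hadj, ?_⟩
      rw [Walk.length_cons] at hp
      have := G.dist_le p'
      omega
  choose! par hadj hdist using hpar
  have hle : (B.erase r).card ≤ E.card := by
    refine Finset.card_le_card_of_injOn (fun b => s(b, par b)) (fun b hb => ?_) ?_
    · exact ((fromEdgeSet_adj _).1 (hadj b hb)).1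
    · intro b hb c hc hbc
      rcases Sym2.eq_iff.1 hbc with ⟨h1, -⟩ | ⟨h1, h2⟩
      · exact h1
      · have h3 := hdist b hb
        have h4 := hdist c hc
        rw [h2] at h3
        rw [← h1] at h4
        omega
  have := Finset.pred_card_le_card_erase (s := B) (a := r)
  omega

theorem reachable_of_steps_mem {β : Type*} (E : Finset (Sym2 β)) (v : ℕ → β) {a b : ℕ}
    (hab : a ≤ b) (h : ∀ t, a ≤ t → t < b → s(v t, v (t + 1)) ∈ E) :
    (fromEdgeSet (E : Set (Sym2 β))).Reachable (v a) (v b) := by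
  induction b, hab using Nat.le_induction with
  | base => exact Reachable.refl _
  | succ b hab ih =>
    refine (ih fun t h1 h2 => h t h1 (by omega)).trans ?_
    by_cases hne : v b = v (b + 1)
    · rw [hne]
    · exact Adj.reachable ((fromEdgeSet_adj _).2 ⟨h b hab (by omega), hne⟩)

theorem two_mul_card_image_le {ι γ : Type*} [DecidableEq γ] (I : Finset ι) (f : ι → γ)
    (h : ∀ e, Even (I.filter fun i => f i = e).card) : 2 * (I.image f).card ≤ I.card := by
  rw [Finset.card_eq_sum_card_image f I, mul_comm, ← smul_eq_mul]
  refine Finset.card_nsmul_le_sum _ _ _ fun e he => ?_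
  obtain ⟨i, hi, hie⟩ := Finset.mem_image.1 he
  have : 0 < (I.filter fun i => f i = e).card :=
    Finset.card_pos.2 ⟨i, Finset.mem_filter.2 ⟨hi, hie⟩⟩
  obtain ⟨k, hk⟩ := h e
  omega

/-- The block bound for two closed walks of length `2q` whose steps, taken together, use every
edge an even number of times, and what happens when the bound is attained. -/
theorem card_union_of_even_steps {β : Type*} [DecidableEq β] {q : ℕ} (v v' : ℕ → β)
    (hv : v (2 * q) = v 0) (hv' : v' (2 * q) = v' 0)
    (heven : ∀ e, Even (((Finset.range (2 * q)).filter fun t => s(v t, v (t + 1)) = e).card +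
      ((Finset.range (2 * q)).filter fun t => s(v' t, v' (t + 1)) = e).card)) :
    ((Finset.range (2 * q)).image v ∪ (Finset.range (2 * q)).image v').card ≤ 2 * q + 2 ∧
    (((Finset.range (2 * q)).image v ∪ (Finset.range (2 * q)).image v').card = 2 * q + 2 →
      (∀ s < 2 * q, ∀ t < 2 * q, v s ≠ v' t) ∧
      ((Finset.range (2 * q)).image v).card = q + 1 ∧
      ((Finset.range (2 * q)).image v').card = q + 1 ∧
      (∀ e, Even ((Finset.range (2 * q)).filter fun t => s(v t, v (t + 1)) = e).card) ∧
      (∀ e, Even ((Finset.range (2 * q)).filter fun t => s(v' t, v' (t + 1)) = e).card)) := by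
  set R := Finset.range (2 * q) with hR
  set E : Finset (Sym2 β) := R.image fun t => s(v t, v (t + 1)) with hE
  set E' : Finset (Sym2 β) := R.image fun t => s(v' t, v' (t + 1)) with hE'
  have hmem : ∀ t < 2 * q, s(v t, v (t + 1)) ∈ E := fun t ht =>
    Finset.mem_image.2 ⟨t, Finset.mem_range.2 ht, rfl⟩
  have hmem' : ∀ t < 2 * q, s(v' t, v' (t + 1)) ∈ E' := fun t ht =>
    Finset.mem_image.2 ⟨t, Finset.mem_range.2 ht, rfl⟩
  -- Walks that meet form one connected graph with at most `2 * q` distinct edges, hence at most `2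
  -- * q + 1` vertices.
  by_cases hshare : ∃ s < 2 * q, ∃ t < 2 * q, v s = v' t
  · obtain ⟨s, hs, t, ht, hst⟩ := hshare
    have hcard : 2 * (E ∪ E').card ≤ 4 * q := by
      have h := two_mul_card_image_le (R.disjSum R)
        (Sum.elim (fun t => s(v t, v (t + 1))) fun t => s(v' t, v' (t + 1))) fun e => by
          have h1 := heven e
          rw [Finset.card_filter, Finset.card_filter] at h1
          rw [Finset.card_filter, Finset.sum_disjSum]
          exact h1
      have himg : (R.disjSum R).image
          (Sum.elim (fun t => s(v t, v (t + 1))) fun t => s(v' t, v' (t + 1))) = E ∪ E' := by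
        ext e
        simp [hE, hE', Finset.mem_disjSum]
      rw [himg, Finset.card_disjSum, hR, Finset.card_range] at h
      omega
    have hB := card_le_card_add_one_of_reachable (E ∪ E') (R.image v ∪ R.image v') (v s) (by
      intro b hb
      rcases Finset.mem_union.1 hb with hb | hb
      · obtain ⟨a, ha, rfl⟩ := Finset.mem_image.1 hb
        rw [hR, Finset.mem_range] at ha
        exact (reachable_of_steps_mem _ v (Nat.zero_le a)
            fun t _ h => Finset.mem_union_left _ (hmem t (by omega))).symm.trans
          (reachable_of_steps_mem _ v (Nat.zero_le s)
            fun t _ h => Finset.mem_union_left _ (hmem t (by omega)))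
      · obtain ⟨a, ha, rfl⟩ := Finset.mem_image.1 hb
        rw [hR, Finset.mem_range] at ha
        rw [hst]
        exact (reachable_of_steps_mem _ v' (Nat.zero_le a)
            fun t _ h => Finset.mem_union_right _ (hmem' t (by omega))).symm.trans
          (reachable_of_steps_mem _ v' (Nat.zero_le t)
            fun t _ h => Finset.mem_union_right _ (hmem' t (by omega))))
    omega
  -- Disjoint walks share no edge, so each is even by itself and visits at most `q + 1` vertices.
  · push Not at hshare
    have hwrap : ∀ t < 2 * q, ∃ t' < 2 * q, v (t + 1) = v t' := fun t ht => by
      by_cases h : t + 1 < 2 * q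
      · exact ⟨t + 1, h, rfl⟩
      · exact ⟨0, by omega, by rw [← hv]; congr 1; omega⟩
    have hwrap' : ∀ t < 2 * q, ∃ t' < 2 * q, v' (t + 1) = v' t' := fun t ht => by
      by_cases h : t + 1 < 2 * q
      · exact ⟨t + 1, h, rfl⟩
      · exact ⟨0, by omega, by rw [← hv']; congr 1; omega⟩
    have hdisj : ∀ s < 2 * q, ∀ t < 2 * q, s(v s, v (s + 1)) ≠ s(v' t, v' (t + 1)) := by
      intro s hs t ht h
      rcases Sym2.eq_iff.1 h with ⟨h1, -⟩ | ⟨h1, -⟩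
      · exact hshare s hs t ht h1
      · obtain ⟨t', ht', h2⟩ := hwrap' t ht
        exact hshare s hs t' ht' (h1.trans h2)
    have hev : ∀ e, Even (R.filter fun t => s(v t, v (t + 1)) = e).card := by
      intro e
      by_cases he : ∃ t ∈ R, s(v t, v (t + 1)) = e
      · obtain ⟨t, ht, rfl⟩ := he
        have h := heven s(v t, v (t + 1))
        rwa [(Finset.filter_eq_empty_iff (p := fun t' => s(v' t', v' (t' + 1)) = _)).2,
          Finset.card_empty, add_zero] at h
        exact fun t' ht' h' => hdisj t (Finset.mem_range.1 ht) t' (Finset.mem_range.1 ht') h'.symm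
      · push Not at he
        rw [Finset.filter_eq_empty_iff.2 fun t ht => he t ht]
        simp
    have hev' : ∀ e, Even (R.filter fun t => s(v' t, v' (t + 1)) = e).card := by
      intro e
      have h := (Nat.even_add.1 (heven e)).1 (hev e)
      exact h
    have h1 := two_mul_card_image_le _ _ hev
    have h2 := two_mul_card_image_le _ _ hev'
    have hR' : R.card = 2 * q := Finset.card_range _
    rw [← hE, hR'] at h1
    rw [← hE', hR'] at h2
    have hB := card_le_card_add_one_of_reachable E (R.image v) (v 0) (by
      intro b hb
      obtain ⟨a, ha, rfl⟩ := Finset.mem_image.1 hb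
      rw [hR, Finset.mem_range] at ha
      exact (reachable_of_steps_mem _ v (Nat.zero_le a) fun t _ h => hmem t (by omega)).symm)
    have hB' := card_le_card_add_one_of_reachable E' (R.image v') (v' 0) (by
      intro b hb
      obtain ⟨a, ha, rfl⟩ := Finset.mem_image.1 hb
      rw [hR, Finset.mem_range] at ha
      exact (reachable_of_steps_mem _ v' (Nat.zero_le a) fun t _ h => hmem' t (by omega)).symm)
    have hu := Finset.card_union_le (R.image v) (R.image v')
    refine ⟨by omega, fun h => ⟨hshare, by omega, by omega, hev, hev'⟩⟩

/-! ### Tree walks: coincidences at even and at odd positions. -/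

/-- A closed walk of length `2q` without loops that visits `q + 1` points and uses every edge an
even number of times. -/
structure IsTreeWalk {β : Type*} [DecidableEq β] (q : ℕ) (v : ℕ → β) : Prop where
  closed : v (2 * q) = v 0
  even : ∀ e, Even ((Finset.range (2 * q)).filter fun t => s(v t, v (t + 1)) = e).card
  card : ((Finset.range (2 * q)).image v).card = q + 1
  ne : ∀ t < 2 * q, v t ≠ v (t + 1)

namespace IsTreeWalk

variable {β : Type*} {q : ℕ} {v : ℕ → β}

/-- The set of steps `s, …, t - 1` contains both traversals of each of its edges. -/
def ClosedSteps (q : ℕ) (v : ℕ → β) (s t : ℕ) : Prop :=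
  ∀ k, s ≤ k → k < t → ∀ l < 2 * q, l ≠ k → s(v l, v (l + 1)) = s(v k, v (k + 1)) →
    s ≤ l ∧ l < t

theorem ClosedSteps.inter {s t s' t' a b : ℕ} (h : ClosedSteps q v s t)
    (h' : ClosedSteps q v s' t') (ha : a = max s s') (hb : b = min t t') :
    ClosedSteps q v a b := by
  intro k hk hk' l hl hlk he
  have h1 := h k (by omega) (by omega) l hl hlk he
  have h2 := h' k (by omega) (by omega) l hl hlk he
  omega

variable [DecidableEq β]

/-- Evenness allows at most `q` distinct edges; connecting `q + 1` points requires at least `q`. -/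
theorem card_edges (h : IsTreeWalk q v) :
    ((Finset.range (2 * q)).image fun t => s(v t, v (t + 1))).card = q := by
  have h1 := two_mul_card_image_le _ _ h.even
  have h2 := card_le_card_add_one_of_reachable
    ((Finset.range (2 * q)).image fun t => s(v t, v (t + 1))) ((Finset.range (2 * q)).image v)
    (v 0) (by
      intro b hb
      obtain ⟨a, ha, rfl⟩ := Finset.mem_image.1 hb
      rw [Finset.mem_range] at ha
      exact (reachable_of_steps_mem _ v (Nat.zero_le a) fun t _ h =>
        Finset.mem_image.2 ⟨t, Finset.mem_range.2 (by omega), rfl⟩).symm)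
  rw [Finset.card_range] at h1
  rw [h.card] at h2
  omega

/-- `2 * q` steps use `q` edges, each at least twice, so there is no slack. -/
theorem card_fiber (h : IsTreeWalk q v) {t : ℕ} (ht : t < 2 * q) :
    ((Finset.range (2 * q)).filter fun s => s(v s, v (s + 1)) = s(v t, v (t + 1))).card = 2 := by
  have hsum := Finset.card_eq_sum_card_image (fun t => s(v t, v (t + 1))) (Finset.range (2 * q))
  have hge : ∀ e ∈ (Finset.range (2 * q)).image fun t => s(v t, v (t + 1)),
      2 ≤ ((Finset.range (2 * q)).filter fun s => s(v s, v (s + 1)) = e).card := by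
    intro e he
    obtain ⟨i, hi, hie⟩ := Finset.mem_image.1 he
    have : 0 < ((Finset.range (2 * q)).filter fun s => s(v s, v (s + 1)) = e).card :=
      Finset.card_pos.2 ⟨i, Finset.mem_filter.2 ⟨hi, hie⟩⟩
    obtain ⟨k, hk⟩ := h.even e
    omega
  have htot : ∑ e ∈ (Finset.range (2 * q)).image (fun t => s(v t, v (t + 1))), 2 =
      ∑ e ∈ (Finset.range (2 * q)).image (fun t => s(v t, v (t + 1))),
        ((Finset.range (2 * q)).filter fun s => s(v s, v (s + 1)) = e).card := by
    rw [← hsum, Finset.sum_const, h.card_edges, Finset.card_range, smul_eq_mul, mul_comm]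
  exact ((Finset.sum_eq_sum_iff_of_le hge).1 htot _
    (Finset.mem_image.2 ⟨t, Finset.mem_range.2 ht, rfl⟩)).symm

theorem exists_partner (h : IsTreeWalk q v) {t : ℕ} (ht : t < 2 * q) :
    ∃ u < 2 * q, u ≠ t ∧ s(v u, v (u + 1)) = s(v t, v (t + 1)) := by
  obtain ⟨u, hu, hne⟩ := Finset.exists_mem_ne (by rw [h.card_fiber ht]; norm_num) t
  rw [Finset.mem_filter, Finset.mem_range] at hu
  exact ⟨u, hu.1, hne, hu.2⟩

theorem partner_unique (h : IsTreeWalk q v) {t u w : ℕ} (ht : t < 2 * q) (hu : u < 2 * q)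
    (hw : w < 2 * q) (hut : u ≠ t) (hwt : w ≠ t) (hue : s(v u, v (u + 1)) = s(v t, v (t + 1)))
    (hwe : s(v w, v (w + 1)) = s(v t, v (t + 1))) : u = w := by
  by_contra hne
  have hsub : ({t, u, w} : Finset ℕ) ⊆
      (Finset.range (2 * q)).filter fun s => s(v s, v (s + 1)) = s(v t, v (t + 1)) := by
    intro a ha
    simp only [Finset.mem_insert, Finset.mem_singleton] at ha
    rw [Finset.mem_filter, Finset.mem_range]
    rcases ha with rfl | rfl | rfl
    · exact ⟨ht, rfl⟩
    · exact ⟨hu, hue⟩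
    · exact ⟨hw, hwe⟩
  have hc := Finset.card_le_card hsub
  rw [h.card_fiber ht, Finset.card_eq_three.2 ⟨t, u, w, hut.symm, hwt.symm, hne, rfl⟩] at hc
  omega

/-- The points visited between two traversals of the same edge are not visited at other times. -/
theorem ne_of_between (h : IsTreeWalk q v) {s u i j : ℕ} (hsu : s < u) (hu : u < 2 * q)
    (he : s(v u, v (u + 1)) = s(v s, v (s + 1))) (hi : s < i) (hi' : i ≤ u)
    (hj : j ≤ s ∨ u < j) (hj' : j ≤ 2 * q) : v i ≠ v j := by
  intro hij
  -- Without this edge the inner and the outer stretch of the walk each stay connected; a common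
  -- point would connect all `q + 1` points by `q - 1` edges.
  set E := (Finset.range (2 * q)).image fun t => s(v t, v (t + 1)) with hE
  set E' := E.erase s(v s, v (s + 1)) with hE'
  have hmem : ∀ t < 2 * q, t ≠ s → t ≠ u → s(v t, v (t + 1)) ∈ E' := by
    intro t ht hts htu
    refine Finset.mem_erase.2 ⟨fun h' => htu ?_,
      Finset.mem_image.2 ⟨t, Finset.mem_range.2 ht, rfl⟩⟩
    exact h.partner_unique (by omega) ht hu hts (by omega) h' he
  have hreach : ∀ a b, a ≤ b → (∀ t, a ≤ t → t < b → t < 2 * q ∧ t ≠ s ∧ t ≠ u) →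
      (fromEdgeSet (E' : Set (Sym2 β))).Reachable (v a) (v b) := fun a b hab ht =>
    reachable_of_steps_mem _ v hab fun t h1 h2 =>
      hmem t (ht t h1 h2).1 (ht t h1 h2).2.1 (ht t h1 h2).2.2
  have hin : ∀ k, s < k → k ≤ u → (fromEdgeSet (E' : Set (Sym2 β))).Reachable (v k) (v i) := by
    intro k h1 h2
    rcases le_total k i with h3 | h3
    · exact hreach k i h3 fun t _ _ => by omega
    · exact (hreach i k h3 fun t _ _ => by omega).symm
  have hout : ∀ k ≤ 2 * q, (k ≤ s ∨ u < k) →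
      (fromEdgeSet (E' : Set (Sym2 β))).Reachable (v k) (v 0) := by
    rintro k hk (h1 | h1)
    · exact (hreach 0 k (Nat.zero_le k) fun t _ _ => by omega).symm
    · rw [← h.closed]
      exact hreach k (2 * q) hk fun t _ _ => by omega
  have hB := card_le_card_add_one_of_reachable E' ((Finset.range (2 * q)).image v) (v i) (by
    intro b hb
    obtain ⟨k, hk, rfl⟩ := Finset.mem_image.1 hb
    rw [Finset.mem_range] at hk
    by_cases hk' : s < k ∧ k ≤ u
    · exact hin k hk'.1 hk'.2
    · rw [hij]
      exact (hout k hk.le (by omega)).trans (hout j hj' hj).symm)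
  have hc : E'.card = q - 1 := by
    rw [hE', Finset.card_erase_of_mem (Finset.mem_image.2
      ⟨s, Finset.mem_range.2 (by omega), rfl⟩), h.card_edges]
  rw [h.card] at hB
  omega

/-- Traversals in the same direction would put the starting point of the edge both between them and
outside, against `ne_of_between`. -/
theorem partner_reverse (h : IsTreeWalk q v) {s u : ℕ} (hs : s < 2 * q) (hu : u < 2 * q)
    (hsu : u ≠ s) (he : s(v u, v (u + 1)) = s(v s, v (s + 1))) :
    v u = v (s + 1) ∧ v (u + 1) = v s := by
  rcases Sym2.eq_iff.1 he with ⟨h1, -⟩ | h1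
  · exfalso
    rcases lt_or_gt_of_ne hsu with h2 | h2
    · exact h.ne_of_between h2 hs he.symm h2 le_rfl (Or.inl le_rfl) (by omega) h1.symm
    · exact h.ne_of_between h2 hu he h2 le_rfl (Or.inl le_rfl) (by omega) h1
  · exact h1

/-- If only one traversal of an edge fell into the interval, exactly one of the positions `s`, `t`
would lie between the two traversals, against `ne_of_between`. -/
theorem closedSteps_of_eq (h : IsTreeWalk q v) {s t : ℕ} (ht : t ≤ 2 * q)
    (hv : v s = v t) : ClosedSteps q v s t := by
  intro k hsk hkt l hl hlk he
  by_contra hcon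
  by_cases h1 : l < s
  · exact h.ne_of_between (s := l) (u := k) (by omega) (by omega) he.symm h1 hsk (Or.inr hkt) ht hv
  · exact h.ne_of_between (s := k) (u := l) (by omega) hl he hkt (by omega) (Or.inl hsk)
      (by omega) hv.symm

/-- Decompose as for Dyck words: step `s` is undone by some step `l`, and the steps strictly between
them, as well as those after `l`, again form closed intervals. -/
theorem eq_and_even_of_closedSteps (h : IsTreeWalk q v) {s t : ℕ} (hst : s ≤ t) (ht : t ≤ 2 * q)
    (hc : ClosedSteps q v s t) : v s = v t ∧ Even (t - s) := by
  induction hn : t - s using Nat.strong_induction_on generalizing s t with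
  | _ n ih =>
    rcases hst.eq_or_lt with rfl | hlt
    · exact ⟨rfl, by rw [← hn]; simp⟩
    obtain ⟨l, hl, hls, he⟩ := h.exists_partner (t := s) (by omega)
    obtain ⟨h1, h2⟩ := hc s le_rfl hlt l hl hls he
    obtain ⟨h3, h4⟩ := h.partner_reverse (by omega) hl hls he
    have hin : ClosedSteps q v (s + 1) l := h.closedSteps_of_eq hl.le h3.symm
    have hrest : ClosedSteps q v (l + 1) t := by
      intro k hk hkt m hm hmk hme
      obtain ⟨h5, h6⟩ := hc k (by omega) hkt m hm hmk hme
      by_contra hcon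
      have h7 : m ≠ s := by
        rintro rfl
        have := h.partner_unique (t := m) (by omega) hl (w := k) (by omega) hls (Ne.symm hmk)
          he hme.symm
        omega
      have h8 : m ≠ l := by
        rintro rfl
        have := h.partner_unique (t := m) hl (u := s) (by omega) (w := k) (by omega)
          (Ne.symm hls) (Ne.symm hmk) he.symm hme.symm
        omega
      have := hin m (by omega) (by omega) k (by omega) (Ne.symm hmk) hme.symm
      omega
    obtain ⟨h5, h6⟩ := ih _ (by omega) (by omega) hl.le hin rfl
    obtain ⟨h7, h8⟩ := ih _ (by omega) (by omega) ht hrest rfl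
    refine ⟨by rw [← h4, h7], ?_⟩
    have : n = (l - (s + 1)) + (t - (l + 1)) + 2 := by omega
    rw [this]
    exact (h6.add h8).add even_two

theorem even_sub_of_eq (h : IsTreeWalk q v) {s t : ℕ} (hst : s ≤ t) (ht : t ≤ 2 * q)
    (hv : v s = v t) : Even (t - s) :=
  (h.eq_and_even_of_closedSteps hst ht (h.closedSteps_of_eq ht hv)).2

theorem even_ne_odd (h : IsTreeWalk q v) {i j : ℕ} (hi : i < q) (hj : j < q) :
    v (2 * i) ≠ v (2 * j + 1) := by
  intro he
  rcases le_total (2 * i) (2 * j + 1) with h1 | h1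
  · obtain ⟨k, hk⟩ := h.even_sub_of_eq h1 (by omega) he
    omega
  · obtain ⟨k, hk⟩ := h.even_sub_of_eq h1 (by omega) he.symm
    omega

/-- Closed intervals of steps are stable under intersection, so the interval from `2 * b` to `2 * c`
is closed. -/
theorem noncrossing (h : IsTreeWalk q v) {a b c d : ℕ} (hab : a < b) (hbc : b < c) (hcd : c < d)
    (hd : d < q) (hac : v (2 * a) = v (2 * c)) (hbd : v (2 * b) = v (2 * d)) :
    v (2 * a) = v (2 * b) := by
  have h1 := h.closedSteps_of_eq (by omega) hac
  have h2 := h.closedSteps_of_eq (by omega) hbd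
  have h3 := h1.inter h2 (a := 2 * b) (b := 2 * c) (by omega) (by omega)
  rw [hac]
  exact ((h.eq_and_even_of_closedSteps (by omega) (by omega) h3).1).symm

/-- This is the Kreweras complement. A class of even positions only partly in (i, j] would, by
intersection, give a closed interval of odd length. Conversely, a step and its partner share an
even-position vertex, so saturation keeps the partner inside the interval. -/
theorem odd_eq_iff (h : IsTreeWalk q v) {i j : ℕ} (hij : i ≤ j) (hj : j < q) :
    v (2 * i + 1) = v (2 * j + 1) ↔
      ∀ a < q, ∀ b < q, v (2 * a) = v (2 * b) → (i < a ∧ a ≤ j) → (i < b ∧ b ≤ j) := by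
  constructor
  · intro he a ha b hb hab haij
    by_contra hcon
    have h1 := h.closedSteps_of_eq (by omega) he
    rcases lt_or_ge j b with hjb | hjb
    · have h2 := h.closedSteps_of_eq (by omega) hab
      have h3 := h1.inter h2 (a := 2 * a) (b := 2 * j + 1) (by omega) (by omega)
      obtain ⟨k, hk⟩ := (h.eq_and_even_of_closedSteps (by omega) (by omega) h3).2
      omega
    · have h2 := h.closedSteps_of_eq (by omega) hab.symm
      have h3 := h1.inter h2 (a := 2 * i + 1) (b := 2 * a) (by omega) (by omega)
      obtain ⟨k, hk⟩ := (h.eq_and_even_of_closedSteps (by omega) (by omega) h3).2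
      omega
  · intro hsat
    refine (h.eq_and_even_of_closedSteps (by omega) (by omega) ?_).1
    intro k hk hkj l hl hlk he
    obtain ⟨h1, h2⟩ := h.partner_reverse (by omega) hl hlk he
    have hpar : (Even k ∧ ¬ Even l) ∨ (¬ Even k ∧ Even l) := by
      rcases le_total k (l + 1) with h3 | h3
      · obtain ⟨m, hm⟩ := h.even_sub_of_eq h3 (by omega) h2.symm
        simp only [Nat.even_iff]
        omega
      · obtain ⟨m, hm⟩ := h.even_sub_of_eq h3 (by omega) h2
        simp only [Nat.even_iff]
        omega
    rcases hpar with ⟨hke, hlo⟩ | ⟨hko, hle⟩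
    · obtain ⟨a, ha⟩ := hke
      rw [Nat.not_even_iff_odd] at hlo
      obtain ⟨b, hb⟩ := hlo
      by_cases hbq : b + 1 < q
      · have := hsat a (by omega) (b + 1) hbq
          (by rw [show 2 * a = k by omega, show 2 * (b + 1) = l + 1 by omega, h2]) (by omega)
        omega
      -- Here `l` is the last step; its endpoint is position 0 by closedness, and 0 never lies in
      -- (i, j].
      · have := hsat a (by omega) 0 (by omega)
          (by rw [mul_zero, ← h.closed, show 2 * a = k by omega, show 2 * q = l + 1 by omega, h2])
          (by omega)
        omega
    · obtain ⟨b, hb⟩ := hle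
      rw [Nat.not_even_iff_odd] at hko
      obtain ⟨a, ha⟩ := hko
      have := hsat (a + 1) (by omega) b (by omega)
        (by rw [show 2 * (a + 1) = k + 1 by omega, show 2 * b = l by omega, h1]) (by omega)
      omega

end IsTreeWalk

/-! ### Cross edges force a refinement of partitions. -/

namespace IsTreeWalk

variable {β : Type*} [DecidableEq β] {q : ℕ} {v : ℕ → β}

/-- The step that retraces the step into an even position starts at an even position. -/
theorem exists_retrace (h : IsTreeWalk q v) {m : ℕ} (hm : m < q) :
    ∃ p < q, s(v (2 * p), v (2 * p + 1)) = s(v (2 * m + 1), v (2 * m + 1 + 1)) ∧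
      v (2 * p) = v (2 * (m + 1)) ∧ v (2 * p + 1) = v (2 * m + 1) := by
  obtain ⟨l, hl, hlm, he⟩ := h.exists_partner (t := 2 * m + 1) (by omega)
  obtain ⟨h1, h2⟩ := h.partner_reverse (by omega) hl hlm he
  have hle : Even l := by
    rcases le_total l (2 * m + 1 + 1) with h3 | h3
    · have h4 := h.even_sub_of_eq h3 (by omega) h1
      rw [Nat.even_iff] at *
      omega
    · have h4 := h.even_sub_of_eq h3 (by omega) h1.symm
      rw [Nat.even_iff] at *
      omega
  obtain ⟨p, hp⟩ := hle
  obtain rfl : l = 2 * p := by omega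
  exact ⟨p, by omega, he, h1, h2⟩

/-- If the edges between the odd positions of a tree walk and a second cyclic sequence `z` are all
used an even number of times, then `z` respects coincidences of even positions. -/
theorem eq_of_even_cross (h : IsTreeWalk q v) {γ : Type*} [DecidableEq γ] (z : ℕ → γ)
    (heven : ∀ e a, Even (((Finset.range q).filter fun m => v (2 * m + 1) = e ∧ z m = a).card +
      ((Finset.range q).filter fun m => v (2 * m + 1) = e ∧ z (m + 1) = a).card))
    {i j : ℕ} (hij : i ≤ j) (hj : j ≤ q) (hv : v (2 * i) = v (2 * j)) : z i = z j := by
  induction hn : j - i using Nat.strong_induction_on generalizing i j with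
  | _ n ih =>
    rcases hij.eq_or_lt with rfl | hlt
    · rfl
    -- It suffices to treat consecutive members of a class.
    by_cases hk : ∃ k, i < k ∧ k < j ∧ v (2 * k) = v (2 * i)
    · obtain ⟨k, hik, hkj, hk⟩ := hk
      exact (ih _ (by omega) hik.le (by omega) hk.symm rfl).trans
        (ih _ (by omega) hkj.le hj (hk.trans hv) rfl)
    push Not at hk
    -- the step leaving `2 * i` is retraced by the step entering `2 * j`
    have hclosed := h.closedSteps_of_eq (by omega) hv
    have hretr : s(v (2 * i), v (2 * i + 1)) = s(v (2 * (j - 1) + 1), v (2 * (j - 1) + 1 + 1)) ∧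
        v (2 * i + 1) = v (2 * (j - 1) + 1) := by
      obtain ⟨l, hl, hli, he⟩ := h.exists_partner (t := 2 * i) (by omega)
      obtain ⟨h1, h2⟩ := hclosed _ le_rfl (by omega) l hl hli he
      obtain ⟨h3, h4⟩ := h.partner_reverse (by omega) hl hli he
      have h5 := h.even_sub_of_eq (s := 2 * i) (t := l + 1) (by omega) (by omega) h4.symm
      obtain ⟨k, hk'⟩ := h5
      obtain rfl : l = 2 * (j - 1) + 1 := by
        by_contra hne
        exact hk (i + k) (by omega) (by omega) (by rw [← h4]; congr 1; omega)
      exact ⟨he.symm, h3.symm⟩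
    obtain ⟨hre, hroot⟩ := hretr
    set e := v (2 * i + 1) with he
    set M := (Finset.range q).filter fun m => v (2 * m + 1) = e with hM
    have hMmem : ∀ m, m ∈ M ↔ m < q ∧ v (2 * m + 1) = e := fun m => by
      rw [hM, Finset.mem_filter, Finset.mem_range]
    have hMrange : ∀ m ∈ M, i ≤ m ∧ m ≤ j - 1 := by
      intro m hm
      rw [hMmem] at hm
      by_contra hcon
      exact h.ne_of_between (s := 2 * i) (u := 2 * (j - 1) + 1) (i := 2 * i + 1)
        (j := 2 * m + 1) (by omega) (by omega) hre.symm (by omega) (by omega) (by omega) (by omega)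
        (by rw [hm.2])
    have hiM : i ∈ M := (hMmem i).2 ⟨by omega, rfl⟩
    have hjM : j - 1 ∈ M := (hMmem _).2 ⟨by omega, hroot.symm⟩
    -- At the vertex `e`, the end `z (m + 1)` with `m ≠ j - 1` cancels against `z (π m)`: these
    -- agree by induction, both indices lying strictly between `i` and `j`. Only `z i` and `z j`
    -- remain, so parity makes them equal.
    choose! π hπq hπe hπ1 hπ2 using fun (m : ℕ) (hm : m < q) => h.exists_retrace hm
    have hπM : ∀ m ∈ M.erase (j - 1), π m ∈ M.erase i := by
      intro m hm
      rw [Finset.mem_erase] at hm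
      have hmr := hMrange m hm.2
      have hm' := (hMmem m).1 hm.2
      refine Finset.mem_erase.2 ⟨fun hπi => ?_, (hMmem _).2 ⟨hπq m hm'.1, ?_⟩⟩
      · have := hπ1 m hm'.1
        rw [hπi] at this
        exact hk (m + 1) (by omega) (by omega) this.symm
      · rw [hπ2 m hm'.1, hm'.2]
    have hπz : ∀ m ∈ M.erase (j - 1), z (π m) = z (m + 1) := by
      intro m hm
      have h1 := hπM m hm
      rw [Finset.mem_erase] at hm h1
      have hmr := hMrange m hm.2
      have hπr := hMrange _ h1.2
      have hm' := (hMmem m).1 hm.2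
      rcases le_total (π m) (m + 1) with h2 | h2
      · exact ih _ (by omega) h2 (by omega) (hπ1 m hm'.1) rfl
      · exact (ih _ (by omega) h2 (by omega) (hπ1 m hm'.1).symm rfl).symm
    have hπinj : Set.InjOn π (M.erase (j - 1)) := by
      intro a ha b hb hab
      have ha' := (hMmem a).1 (Finset.mem_of_mem_erase ha)
      have hb' := (hMmem b).1 (Finset.mem_of_mem_erase hb)
      have h1 := hπe a ha'.1
      have h2 := hπe b hb'.1
      have hq1 := hπq a ha'.1
      rw [← hab] at h2
      have := h.partner_unique (t := 2 * π a) (u := 2 * a + 1) (w := 2 * b + 1) (by omega)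
        (by omega) (by omega) (by omega) (by omega) h1.symm h2.symm
      omega
    have hsum : ∑ m ∈ M.erase (j - 1), (if z (m + 1) = z i then 1 else 0) =
        ∑ m ∈ M.erase i, if z m = z i then 1 else 0 := by
      have himg : (M.erase (j - 1)).image π = M.erase i := by
        refine Finset.eq_of_subset_of_card_le (Finset.image_subset_iff.2 hπM) ?_
        rw [Finset.card_image_of_injOn hπinj, Finset.card_erase_of_mem hiM,
          Finset.card_erase_of_mem hjM]
      rw [← himg, Finset.sum_image hπinj]
      exact Finset.sum_congr rfl fun m hm => by rw [hπz m hm]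
    have hcount := heven e (z i)
    rw [← Finset.filter_filter, ← Finset.filter_filter, ← hM, Finset.card_filter,
      Finset.card_filter, ← Finset.add_sum_erase M _ hiM, ← Finset.add_sum_erase M _ hjM, hsum,
      if_pos rfl, show j - 1 + 1 = j by omega] at hcount
    by_contra hne
    rw [if_neg (Ne.symm hne)] at hcount
    rw [Nat.even_iff] at hcount
    omega

end IsTreeWalk

/-! ### Noncrossing partitions of intervals: cutting and gluing. -/

/-- A noncrossing partition of the interval `[a, b)`: an equivalence relation on `ℕ` which is
trivial outside of `[a, b)`. -/
structure IsNoncrossing (a b : ℕ) (r : Setoid ℕ) : Prop where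
  supp : ∀ i j, r i j → i = j ∨ (a ≤ i ∧ i < b ∧ a ≤ j ∧ j < b)
  nc : ∀ i j k l, i < j → j < k → k < l → r i k → r j l → r i j

/-- The restriction of an equivalence relation to `[a, b)`. -/
def restrictInterval (a b : ℕ) (r : Setoid ℕ) : Setoid ℕ where
  r i j := i = j ∨ (a ≤ i ∧ i < b ∧ a ≤ j ∧ j < b ∧ r i j)
  iseqv := by
    refine ⟨fun i => Or.inl rfl, ?_, ?_⟩
    · rintro i j (h | h)
      · exact Or.inl h.symm
      · exact Or.inr ⟨h.2.2.1, h.2.2.2.1, h.1, h.2.1, r.symm h.2.2.2.2⟩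
    · rintro i j k (rfl | h) (rfl | h')
      · exact Or.inl rfl
      · exact Or.inr h'
      · exact Or.inr h
      · exact Or.inr ⟨h.1, h.2.1, h'.2.2.1, h'.2.2.2.1, r.trans h.2.2.2.2 h'.2.2.2.2⟩

theorem restrictInterval_apply {a b : ℕ} {r : Setoid ℕ} {i j : ℕ} :
    restrictInterval a b r i j ↔ i = j ∨ (a ≤ i ∧ i < b ∧ a ≤ j ∧ j < b ∧ r i j) := Iff.rfl

/-- `r₁` below `m` together with `r₂` from `m` on, where the classes of `a` and `m` are joined
if `f` holds. -/
def glue (f : Prop) (a m : ℕ) (r₁ r₂ : Setoid ℕ) : Setoid ℕ where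
  r i j := (i < m ∧ j < m ∧ r₁ i j) ∨ (m ≤ i ∧ m ≤ j ∧ r₂ i j) ∨
    (f ∧ ((i < m ∧ m ≤ j ∧ r₁ a i ∧ r₂ m j) ∨ (j < m ∧ m ≤ i ∧ r₁ a j ∧ r₂ m i)))
  iseqv := by
    refine ⟨fun i => ?_, ?_, ?_⟩
    · rcases lt_or_ge i m with h | h
      · exact Or.inl ⟨h, h, r₁.refl _⟩
      · exact Or.inr (Or.inl ⟨h, h, r₂.refl _⟩)
    · rintro i j (⟨h, h', h''⟩ | ⟨h, h', h''⟩ | ⟨hf, h | h⟩)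
      · exact Or.inl ⟨h', h, r₁.symm h''⟩
      · exact Or.inr (Or.inl ⟨h', h, r₂.symm h''⟩)
      · exact Or.inr (Or.inr ⟨hf, Or.inr h⟩)
      · exact Or.inr (Or.inr ⟨hf, Or.inl h⟩)
    · have s₁ : ∀ {x y}, r₁ x y → r₁ y x := r₁.symm
      have s₂ : ∀ {x y}, r₂ x y → r₂ y x := r₂.symm
      have t₁ : ∀ {x y z}, r₁ x y → r₁ y z → r₁ x z := r₁.trans
      have t₂ : ∀ {x y z}, r₂ x y → r₂ y z → r₂ x z := r₂.trans
      rintro i j k (⟨h1, h2, h3⟩ | ⟨h1, h2, h3⟩ | ⟨hf, ⟨h1, h2, h3, h4⟩ | ⟨h1, h2, h3, h4⟩⟩)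
        (⟨g1, g2, g3⟩ | ⟨g1, g2, g3⟩ | ⟨gf, ⟨g1, g2, g3, g4⟩ | ⟨g1, g2, g3, g4⟩⟩)
      · exact Or.inl ⟨h1, g2, t₁ h3 g3⟩
      · omega
      · exact Or.inr (Or.inr ⟨gf, Or.inl ⟨h1, g2, t₁ g3 (s₁ h3), g4⟩⟩)
      · omega
      · omega
      · exact Or.inr (Or.inl ⟨h1, g2, t₂ h3 g3⟩)
      · omega
      · exact Or.inr (Or.inr ⟨gf, Or.inr ⟨g1, h1, g3, t₂ g4 (s₂ h3)⟩⟩)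
      · omega
      · exact Or.inr (Or.inr ⟨hf, Or.inl ⟨h1, g2, h3, t₂ h4 g3⟩⟩)
      · omega
      · exact Or.inl ⟨h1, g1, t₁ (s₁ h3) g3⟩
      · exact Or.inr (Or.inr ⟨hf, Or.inr ⟨g2, h2, t₁ h3 g3, h4⟩⟩)
      · omega
      · exact Or.inr (Or.inl ⟨h2, g2, t₂ (s₂ h4) g4⟩)
      · omega

theorem glue_apply {f : Prop} {a m : ℕ} {r₁ r₂ : Setoid ℕ} {i j : ℕ} :
    glue f a m r₁ r₂ i j ↔ (i < m ∧ j < m ∧ r₁ i j) ∨ (m ≤ i ∧ m ≤ j ∧ r₂ i j) ∨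
      (f ∧ ((i < m ∧ m ≤ j ∧ r₁ a i ∧ r₂ m j) ∨ (j < m ∧ m ≤ i ∧ r₁ a j ∧ r₂ m i))) :=
  Iff.rfl

theorem glue_mono {f g : Prop} {a m : ℕ} {r₁ r₂ s₁ s₂ : Setoid ℕ} (hfg : f → g)
    (h₁ : r₁ ≤ s₁) (h₂ : r₂ ≤ s₂) : glue f a m r₁ r₂ ≤ glue g a m s₁ s₂ := by
  rintro i j (⟨h, h', h''⟩ | ⟨h, h', h''⟩ | ⟨hf, ⟨h1, h2, h3, h4⟩ | ⟨h1, h2, h3, h4⟩⟩)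
  · exact Or.inl ⟨h, h', h₁ h''⟩
  · exact Or.inr (Or.inl ⟨h, h', h₂ h''⟩)
  · exact Or.inr (Or.inr ⟨hfg hf, Or.inl ⟨h1, h2, h₁ h3, h₂ h4⟩⟩)
  · exact Or.inr (Or.inr ⟨hfg hf, Or.inr ⟨h1, h2, h₁ h3, h₂ h4⟩⟩)

theorem restrictInterval_mono {a b : ℕ} {r s : Setoid ℕ} (h : r ≤ s) :
    restrictInterval a b r ≤ restrictInterval a b s := by
  rintro i j (h' | ⟨h1, h2, h3, h4, h5⟩)
  · exact Or.inl h'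
  · exact Or.inr ⟨h1, h2, h3, h4, h h5⟩

theorem IsNoncrossing.restrict {a b : ℕ} {r : Setoid ℕ} (h : IsNoncrossing a b r) (c d : ℕ) :
    IsNoncrossing c d (restrictInterval c d r) where
  supp i j hij := by
    rcases hij with h | h
    · exact Or.inl h
    · exact Or.inr ⟨h.1, h.2.1, h.2.2.1, h.2.2.2.1⟩
  nc i j k l hij hjk hkl hik hjl := by
    rcases hik with h1 | ⟨h1, h2, h3, h4, h5⟩
    · omega
    rcases hjl with g1 | ⟨g1, g2, g3, g4, g5⟩
    · omega
    exact Or.inr ⟨h1, h2, g1, g2, h.nc i j k l hij hjk hkl h5 g5⟩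

theorem IsNoncrossing.mono {a b a' b' : ℕ} {r : Setoid ℕ} (h : IsNoncrossing a b r) (ha : a' ≤ a)
    (hb : b ≤ b') : IsNoncrossing a' b' r where
  supp i j hij := by
    have := h.supp i j hij
    omega
  nc := h.nc

/-- The only class that crosses `m` contains `a` and `m`, the least points of the two intervals;
replacing a far point by `a` or `m` moves a crossing into one interval. -/
theorem IsNoncrossing.glue {f : Prop} {a m b : ℕ} {r₁ r₂ : Setoid ℕ} (h₁ : IsNoncrossing a m r₁)
    (h₂ : IsNoncrossing m b r₂) (ham : a < m) (hmb : m ≤ b) (hf : f → m < b) :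
    IsNoncrossing a b (glue f a m r₁ r₂) where
  supp i j hij := by
    rcases hij with ⟨h, h', h''⟩ | ⟨h, h', h''⟩ | ⟨hf', ⟨h1, h2, h3, h4⟩ | ⟨h1, h2, h3, h4⟩⟩
    · have := h₁.supp _ _ h''
      omega
    · have := h₂.supp _ _ h''
      omega
    · have := h₁.supp _ _ h3
      have := h₂.supp _ _ h4
      have := hf hf'
      omega
    · have := h₁.supp _ _ h3
      have := h₂.supp _ _ h4
      have := hf hf'
      omega
  nc i j k l hij hjk hkl hik hjl := by
    have s₁ : ∀ {x y}, r₁ x y → r₁ y x := r₁.symm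
    have s₂ : ∀ {x y}, r₂ x y → r₂ y x := r₂.symm
    have t₁ : ∀ {x y z}, r₁ x y → r₁ y z → r₁ x z := r₁.trans
    have t₂ : ∀ {x y z}, r₂ x y → r₂ y z → r₂ x z := r₂.trans
    rcases hik with ⟨h1, h2, h3⟩ | ⟨h1, h2, h3⟩ | ⟨hf', ⟨h1, h2, h3, h4⟩ | ⟨h1, h2, h3, h4⟩⟩ <;>
    rcases hjl with ⟨g1, g2, g3⟩ | ⟨g1, g2, g3⟩ | ⟨gf, ⟨g1, g2, g3, g4⟩ | ⟨g1, g2, g3, g4⟩⟩ <;>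
    try omega
    · exact Or.inl ⟨h1, g1, h₁.nc i j k l hij hjk hkl h3 g3⟩
    · -- `j` is in the class of `a`, and `i ~ k` surrounds it
      refine Or.inl ⟨h1, g1, ?_⟩
      rcases h₁.supp _ _ h3 with h5 | h5
      · omega
      rcases h5.1.eq_or_lt with rfl | h6
      · exact g3
      · exact t₁ (s₁ (h₁.nc a i j k h6 hij hjk g3 h3)) g3
    · exact Or.inr (Or.inl ⟨h1, g1, h₂.nc i j k l hij hjk hkl h3 g3⟩)
    · refine Or.inr (Or.inr ⟨hf', Or.inl ⟨h1, g1, h3, ?_⟩⟩)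
      rcases g1.eq_or_lt with rfl | h6
      · exact r₂.refl _
      · exact h₂.nc m j k l h6 hjk hkl h4 g3
    · exact Or.inl ⟨h1, g1, t₁ (s₁ h3) g3⟩

theorem restrict_glue_left {f : Prop} {a m : ℕ} {r₁ r₂ : Setoid ℕ} (h₁ : IsNoncrossing a m r₁) :
    restrictInterval a m (glue f a m r₁ r₂) = r₁ := by
  ext i j
  rw [restrictInterval_apply, glue_apply]
  constructor
  · rintro (rfl | ⟨h1, h2, h3, h4, ⟨h, h', h''⟩ | ⟨h, h', h''⟩ | ⟨hf', h | h⟩⟩)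
    · exact r₁.refl _
    · exact h''
    all_goals omega
  · intro h
    rcases h₁.supp _ _ h with h' | ⟨h1, h2, h3, h4⟩
    · exact Or.inl h'
    · exact Or.inr ⟨h1, h2, h3, h4, Or.inl ⟨h2, h4, h⟩⟩

theorem restrict_glue_right {f : Prop} {a m b : ℕ} {r₁ r₂ : Setoid ℕ}
    (h₂ : IsNoncrossing m b r₂) : restrictInterval m b (glue f a m r₁ r₂) = r₂ := by
  ext i j
  rw [restrictInterval_apply, glue_apply]
  constructor
  · rintro (rfl | ⟨h1, h2, h3, h4, ⟨h, h', h''⟩ | ⟨h, h', h''⟩ | ⟨hf', h | h⟩⟩)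
    · exact r₂.refl _
    · omega
    · exact h''
    all_goals omega
  · intro h
    rcases h₂.supp _ _ h with h' | ⟨h1, h2, h3, h4⟩
    · exact Or.inl h'
    · exact Or.inr ⟨h1, h2, h3, h4, Or.inr (Or.inl ⟨h1, h3, h⟩)⟩

/-- A relation across `m` forces `r a m` by `hcross`, and noncrossing then puts both its ends into
the class of `a`. The restrictions thus lose only whether `a` and `m` are related, which `f`
records. -/
theorem glue_restrict {f : Prop} {a m b : ℕ} {r : Setoid ℕ} (h : IsNoncrossing a b r)
    (ham : a < m) (hmb : m ≤ b) (hf : f ↔ m < b ∧ r a m)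
    (hcross : ∀ i l, a ≤ i → i < m → m ≤ l → l < b → r i l → r a m) :
    glue f a m (restrictInterval a m r) (restrictInterval m b r) = r := by
  have s : ∀ {x y}, r x y → r y x := r.symm
  have t : ∀ {x y z}, r x y → r y z → r x z := r.trans
  have key : ∀ i l, i < m → m ≤ l → r i l →
      f ∧ restrictInterval a m r a i ∧ restrictInterval m b r m l := by
    intro i l hi hl hil
    rcases h.supp _ _ hil with h1 | ⟨h1, h2, h3, h4⟩
    · omega
    have ham' := hcross i l h1 hi hl h4 hil
    have hai : r a i := by
      rcases h1.eq_or_lt with rfl | h5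
      · exact r.refl _
      rcases hl.eq_or_lt with rfl | h6
      · exact t ham' (s hil)
      · exact h.nc a i m l h5 hi h6 ham' hil
    exact ⟨hf.2 ⟨by omega, ham'⟩, Or.inr ⟨le_rfl, ham, h1, hi, hai⟩,
      Or.inr ⟨le_rfl, by omega, hl, h4, t (s ham') (t hai hil)⟩⟩
  have out : ∀ {c d i j}, restrictInterval c d r i j → r i j := by
    rintro c d i j (rfl | h)
    · exact r.refl _
    · exact h.2.2.2.2
  ext i j
  rw [glue_apply]
  constructor
  · rintro (⟨-, -, h3⟩ | ⟨-, -, h3⟩ | ⟨hf', ⟨-, -, h3, h4⟩ | ⟨-, -, h3, h4⟩⟩)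
    · exact out h3
    · exact out h3
    · exact t (s (out h3)) (t (hf.1 hf').2 (out h4))
    · exact s (t (s (out h3)) (t (hf.1 hf').2 (out h4)))
  · intro hij
    have hs := h.supp _ _ hij
    rcases lt_or_ge i m with hi | hi <;> rcases lt_or_ge j m with hj | hj
    · refine Or.inl ⟨hi, hj, ?_⟩
      rcases hs with hs | hs
      · exact Or.inl hs
      · exact Or.inr ⟨hs.1, hi, hs.2.2.1, hj, hij⟩
    · obtain ⟨h1, h2, h3⟩ := key i j hi hj hij
      exact Or.inr (Or.inr ⟨h1, Or.inl ⟨hi, hj, h2, h3⟩⟩)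
    · obtain ⟨h1, h2, h3⟩ := key j i hj hi (s hij)
      exact Or.inr (Or.inr ⟨h1, Or.inr ⟨hj, hi, h2, h3⟩⟩)
    · refine Or.inr (Or.inl ⟨hi, hj, ?_⟩)
      rcases hs with hs | hs
      · exact Or.inl hs
      · exact Or.inr ⟨hi, hs.2.1, hj, hs.2.2.2, hij⟩

/-- `m` is the first point after `a` in the class of `a`, or `m = b` if there is none below `b`. -/
structure IsNextInClass (r : Setoid ℕ) (a b m : ℕ) : Prop where
  lt : a < m
  le : m ≤ b
  rel : m < b → r a m
  not_rel : ∀ k, a < k → k < m → ¬ r a k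

theorem exists_isNextInClass (r : Setoid ℕ) {a b : ℕ} (hab : a < b) :
    ∃ m, IsNextInClass r a b m := by
  classical
  have hex : ∃ k, a < k ∧ (k = b ∨ r a k) := ⟨b, hab, Or.inl rfl⟩
  refine ⟨Nat.find hex, (Nat.find_spec hex).1, Nat.find_min' hex ⟨hab, Or.inl rfl⟩,
    fun h => (Nat.find_spec hex).2.resolve_left h.ne, fun k hk hkm hr =>
      Nat.find_min hex hkm ⟨hk, Or.inr hr⟩⟩

theorem IsNextInClass.unique {r : Setoid ℕ} {a b m m' : ℕ} (h : IsNextInClass r a b m)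
    (h' : IsNextInClass r a b m') : m = m' := by
  by_contra hne
  rcases lt_or_gt_of_ne hne with hlt | hlt
  · exact h'.not_rel m h.lt hlt (h.rel (by have := h'.le; omega))
  · exact h.not_rel m' h'.lt hlt (h'.rel (by have := h.le; omega))

/-- As `a` is alone in `r₁`, the cut point can be read off the glued relation; this makes the
decompositions below injective. -/
theorem isNextInClass_glue {a m b : ℕ} {r₁ r₂ : Setoid ℕ} (h₁ : IsNoncrossing (a + 1) m r₁)
    (ham : a < m) (hmb : m ≤ b) : IsNextInClass (glue (m < b) a m r₁ r₂) a b m := by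
  refine ⟨ham, hmb, fun h => Or.inr (Or.inr ⟨h, Or.inl ⟨ham, le_rfl, r₁.refl _, r₂.refl _⟩⟩), ?_⟩
  rintro k hk hkm (⟨-, -, h⟩ | ⟨h, -⟩ | ⟨-, ⟨-, h, -⟩ | ⟨-, h, -⟩⟩)
  · have := h₁.supp _ _ h
    omega
  all_goals omega

/-! ### Counting comparable pairs of noncrossing partitions. -/

/-- Pairs of comparable noncrossing partitions of `[a, b)`. -/
def noncrossingPairs (a b : ℕ) : Set (Setoid ℕ × Setoid ℕ) :=
  {p | IsNoncrossing a b p.1 ∧ IsNoncrossing a b p.2 ∧ p.1 ≤ p.2}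

/-- Pairs of comparable noncrossing partitions of `[a, b)` whose smaller member has the
block `{a}`. -/
def noncrossingPairsSingleton (a b : ℕ) : Set (Setoid ℕ × Setoid ℕ) :=
  {p | IsNoncrossing (a + 1) b p.1 ∧ IsNoncrossing a b p.2 ∧ p.1 ≤ p.2}

/-- Using `encard`, the finiteness of the parts comes with their count. -/
theorem encard_eq_sum_mul {ι α γ : Type*} {S : Set γ} (I : Finset ι) (A B : ι → Set α)
    (a b : ι → ℕ) (g : ι → α → α → γ) (hA : ∀ i ∈ I, (A i).encard = a i)
    (hB : ∀ i ∈ I, (B i).encard = b i)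
    (hS : ∀ p, p ∈ S ↔ ∃ i ∈ I, ∃ x ∈ A i, ∃ y ∈ B i, g i x y = p)
    (hinj : ∀ i ∈ I, ∀ j ∈ I, ∀ x ∈ A i, ∀ y ∈ B i, ∀ x' ∈ A j, ∀ y' ∈ B j,
      g i x y = g j x' y' → i = j ∧ x = x' ∧ y = y') :
    S.encard = (∑ i ∈ I, a i * b i : ℕ) := by
  classical
  have hfA : ∀ i ∈ I, ∃ F : Finset α, (F : Set α) = A i ∧ F.card = a i := fun i hi => by
    have hfin : (A i).Finite := Set.finite_of_encard_eq_coe (hA i hi)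
    refine ⟨hfin.toFinset, hfin.coe_toFinset, ?_⟩
    have := hA i hi
    rw [hfin.encard_eq_coe_toFinset_card] at this
    exact_mod_cast this
  have hfB : ∀ i ∈ I, ∃ F : Finset α, (F : Set α) = B i ∧ F.card = b i := fun i hi => by
    have hfin : (B i).Finite := Set.finite_of_encard_eq_coe (hB i hi)
    refine ⟨hfin.toFinset, hfin.coe_toFinset, ?_⟩
    have := hB i hi
    rw [hfin.encard_eq_coe_toFinset_card] at this
    exact_mod_cast this
  choose! FA hFA hFAc using hfA
  choose! FB hFB hFBc using hfB
  set T : Finset (ι × α × α) := I.biUnion fun i => (FA i ×ˢ FB i).map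
    ⟨fun p => (i, p), fun p p' h => (Prod.mk.inj h).2⟩ with hT
  have hTmem : ∀ t, t ∈ T ↔ t.1 ∈ I ∧ t.2.1 ∈ A t.1 ∧ t.2.2 ∈ B t.1 := by
    rintro ⟨i, x, y⟩
    simp only [hT, Finset.mem_biUnion, Finset.mem_map, Finset.mem_product]
    constructor
    · rintro ⟨i', hi', ⟨x', y'⟩, ⟨hx, hy⟩, h⟩
      obtain ⟨rfl, h'⟩ := Prod.mk.inj h
      obtain ⟨rfl, rfl⟩ := Prod.mk.inj h'
      refine ⟨hi', ?_, ?_⟩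
      · rw [← hFA i' hi']
        exact hx
      · rw [← hFB i' hi']
        exact hy
    · rintro ⟨hi, hx, hy⟩
      refine ⟨i, hi, (x, y), ⟨?_, ?_⟩, rfl⟩
      · rw [← hFA i hi] at hx
        exact hx
      · rw [← hFB i hi] at hy
        exact hy
  have himg : S = ((T.image fun t => g t.1 t.2.1 t.2.2 : Finset γ) : Set γ) := by
    ext p
    rw [hS, Finset.coe_image]
    constructor
    · rintro ⟨i, hi, x, hx, y, hy, rfl⟩
      exact ⟨(i, x, y), (hTmem _).2 ⟨hi, hx, hy⟩, rfl⟩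
    · rintro ⟨t, ht, rfl⟩
      obtain ⟨h1, h2, h3⟩ := (hTmem t).1 ht
      exact ⟨_, h1, _, h2, _, h3, rfl⟩
  rw [himg, Set.encard_coe_eq_coe_finsetCard, Finset.card_image_of_injOn]
  · rw [hT, Finset.card_biUnion]
    · congr 1
      refine Finset.sum_congr rfl fun i hi => ?_
      rw [Finset.card_map, Finset.card_product, hFAc i hi, hFBc i hi]
    · intro i _ j _ hij
      rw [Function.onFun, Finset.disjoint_left]
      rintro t ht ht'
      obtain ⟨p, -, rfl⟩ := Finset.mem_map.1 ht
      obtain ⟨p', -, h⟩ := Finset.mem_map.1 ht'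
      exact hij (congrArg Prod.fst h).symm
  · rintro ⟨i, x, y⟩ ht ⟨j, x', y'⟩ ht' h
    obtain ⟨h1, h2, h3⟩ := (hTmem _).1 ht
    obtain ⟨g1, g2, g3⟩ := (hTmem _).1 ht'
    obtain ⟨e1, e2, e3⟩ := hinj _ h1 _ g1 _ h2 _ h3 _ g2 _ g3 h
    simp only at e1 e2 e3
    rw [e1, e2, e3]

/-- Cut at the next member of the class of `a` in the larger partition. On the left `a` is then
alone in both partitions and can be dropped; the smaller partition is glued with `False`, since `a`
is alone in it. -/
theorem encard_noncrossingPairsSingleton {a i : ℕ} (t : ℕ → ℕ)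
    (ht : ∀ n ≤ i, ∀ c, (noncrossingPairs c (c + n)).encard = t n) :
    (noncrossingPairsSingleton a (a + 1 + i)).encard =
      (∑ s ∈ Finset.range (i + 1), t s * t (i - s) : ℕ) := by
  set j := a + 1 + i with hj
  refine encard_eq_sum_mul (Finset.range (i + 1))
    (fun s => noncrossingPairs (a + 1) (a + 1 + s)) (fun s => noncrossingPairs (a + 1 + s) j)
    t (fun s => t (i - s))
    (fun s x y => (glue False a (a + 1 + s) x.1 y.1,
      glue (a + 1 + s < j) a (a + 1 + s) x.2 y.2)) ?_ ?_ ?_ ?_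
  · intro s hs
    rw [Finset.mem_range] at hs
    exact ht s (by omega) _
  · intro s hs
    rw [Finset.mem_range] at hs
    rw [← ht (i - s) (by omega) (a + 1 + s)]
    congr 2
    omega
  · rintro ⟨P, σ⟩
    constructor
    · rintro ⟨hP, hσ, hle⟩
      simp only at hP hσ hle
      obtain ⟨k, hk⟩ := exists_isNextInClass σ (a := a) (b := j) (by omega)
      have hk1 := hk.lt
      have hk2 := hk.le
      obtain ⟨s, rfl⟩ : ∃ s, k = a + 1 + s := ⟨k - (a + 1), by omega⟩
      refine ⟨s, Finset.mem_range.2 (by omega),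
        (restrictInterval a (a + 1 + s) P, restrictInterval a (a + 1 + s) σ), ⟨?_, ?_, ?_⟩,
        (restrictInterval (a + 1 + s) j P, restrictInterval (a + 1 + s) j σ),
        ⟨hP.restrict _ _, hσ.restrict _ _, restrictInterval_mono hle⟩, ?_⟩
      · refine ⟨?_, (hP.restrict _ _).nc⟩
        rintro x y (h | ⟨h1, h2, h3, h4, h5⟩)
        · exact Or.inl h
        · have := hP.supp _ _ h5
          omega
      · refine ⟨?_, (hσ.restrict _ _).nc⟩
        rintro x y (h | ⟨h1, h2, h3, h4, h5⟩)
        · exact Or.inl h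
        · by_contra hcon
          push Not at hcon
          rcases h1.eq_or_lt with rfl | h6
          · exact hk.not_rel y (by omega) h4 h5
          · rcases h3.eq_or_lt with rfl | h7
            · exact hk.not_rel x (by omega) h2 (σ.symm h5)
            · omega
      · exact restrictInterval_mono hle
      · have hnot : ∀ l, ¬ P a l ∨ a = l := fun l => by
          by_contra hcon
          push Not at hcon
          have := hP.supp _ _ hcon.1
          omega
        refine Prod.ext ?_ ?_
        · refine glue_restrict (hP.mono (Nat.le_succ a) le_rfl) hk1 hk2 ?_ ?_
          · refine ⟨False.elim, fun h => ?_⟩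
            rcases hnot (a + 1 + s) with h' | h'
            · exact h' h.2
            · omega
          -- A relation of `P` across the cut would, through `σ`, put `x` into the class of `a`
          -- before the cut.
          · intro x l hx hxk hkl hl hxl
            exfalso
            have h1 := hP.supp _ _ hxl
            have h2 := hk.rel (by omega)
            refine hk.not_rel x (by omega) hxk ?_
            rcases hkl.eq_or_lt with h3 | h3
            · rw [← h3] at hxl
              exact σ.trans h2 (σ.symm (hle hxl))
            · exact hσ.nc a x _ l (by omega) hxk h3 h2 (hle hxl)
        · refine glue_restrict hσ hk1 hk2 ⟨fun h => ⟨h, hk.rel h⟩, fun h => h.1⟩ ?_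
          intro x l _ _ hkl hl _
          exact hk.rel (by omega)
    · rintro ⟨s, hs, x, ⟨hx1, hx2, hx3⟩, y, ⟨hy1, hy2, hy3⟩, h⟩
      rw [Finset.mem_range] at hs
      obtain ⟨rfl, rfl⟩ := Prod.mk.inj h
      refine ⟨⟨?_, ?_⟩, ?_, glue_mono False.elim hx3 hy3⟩
      · rintro u w (⟨h1, h2, h3⟩ | ⟨h1, h2, h3⟩ | ⟨h1, -⟩)
        · have := hx1.supp _ _ h3
          omega
        · have := hy1.supp _ _ h3
          omega
        · exact h1.elim
      · exact (IsNoncrossing.glue (hx1.mono (Nat.le_succ a) le_rfl) hy1 (by omega) (by omega)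
          False.elim).nc
      · exact IsNoncrossing.glue (hx2.mono (Nat.le_succ a) le_rfl) hy2 (by omega) (by omega) id
  · intro s hs s' hs' x hx y hy x' hx' y' hy' h
    rw [Finset.mem_range] at hs hs'
    obtain ⟨h1, h2⟩ := Prod.mk.inj h
    have hn := isNextInClass_glue (a := a) (b := j) (r₂ := y.2) hx.2.1 (by omega) (by omega)
    have hn' := isNextInClass_glue (a := a) (b := j) (r₂ := y'.2) hx'.2.1 (by omega) (by omega)
    rw [← h2] at hn'
    have he := hn.unique hn'
    obtain rfl : s = s' := by omega
    refine ⟨rfl, Prod.ext ?_ ?_, Prod.ext ?_ ?_⟩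
    · rw [← restrict_glue_left (hx.1.mono (Nat.le_succ a) le_rfl), h1,
        restrict_glue_left (hx'.1.mono (Nat.le_succ a) le_rfl)]
    · rw [← restrict_glue_left (hx.2.1.mono (Nat.le_succ a) le_rfl), h2,
        restrict_glue_left (hx'.2.1.mono (Nat.le_succ a) le_rfl)]
    · rw [← restrict_glue_right hy.1, h1, restrict_glue_right hy'.1]
    · rw [← restrict_glue_right hy.2.1, h2, restrict_glue_right hy'.2.1]

/-- Cut at the next member of the class of `a` in the smaller partition; unless the cut is the end
`b`, the larger one joins `a` to it as well. On the left `a` need only be alone in the smaller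
partition, which is the case counted by `noncrossingPairsSingleton`. -/
theorem encard_noncrossingPairs_succ {a n : ℕ} (t : ℕ → ℕ)
    (ht : ∀ m ≤ n, ∀ c, (noncrossingPairs c (c + m)).encard = t m) :
    (noncrossingPairs a (a + (n + 1))).encard =
      (∑ i ∈ Finset.range (n + 1),
        (∑ s ∈ Finset.range (i + 1), t s * t (i - s)) * t (n - i) : ℕ) := by
  set b := a + (n + 1) with hb
  refine encard_eq_sum_mul (Finset.range (n + 1))
    (fun i => noncrossingPairsSingleton a (a + 1 + i)) (fun i => noncrossingPairs (a + 1 + i) b)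
    (fun i => ∑ s ∈ Finset.range (i + 1), t s * t (i - s)) (fun i => t (n - i))
    (fun i x y => (glue (a + 1 + i < b) a (a + 1 + i) x.1 y.1,
      glue (a + 1 + i < b) a (a + 1 + i) x.2 y.2)) ?_ ?_ ?_ ?_
  · intro i hi
    rw [Finset.mem_range] at hi
    exact encard_noncrossingPairsSingleton t fun m hm c => ht m (by omega) c
  · intro i hi
    rw [Finset.mem_range] at hi
    rw [← ht (n - i) (by omega) (a + 1 + i)]
    congr 2
    omega
  · rintro ⟨P, σ⟩
    constructor
    · rintro ⟨hP, hσ, hle⟩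
      simp only at hP hσ hle
      obtain ⟨k, hk⟩ := exists_isNextInClass P (a := a) (b := b) (by omega)
      have hk1 := hk.lt
      have hk2 := hk.le
      obtain ⟨i, rfl⟩ : ∃ i, k = a + 1 + i := ⟨k - (a + 1), by omega⟩
      refine ⟨i, Finset.mem_range.2 (by omega),
        (restrictInterval a (a + 1 + i) P, restrictInterval a (a + 1 + i) σ), ⟨?_, ?_, ?_⟩,
        (restrictInterval (a + 1 + i) b P, restrictInterval (a + 1 + i) b σ),
        ⟨hP.restrict _ _, hσ.restrict _ _, restrictInterval_mono hle⟩, ?_⟩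
      · refine ⟨?_, (hP.restrict _ _).nc⟩
        rintro x y (h | ⟨h1, h2, h3, h4, h5⟩)
        · exact Or.inl h
        · by_contra hcon
          push Not at hcon
          rcases h1.eq_or_lt with rfl | h6
          · exact hk.not_rel y (by omega) h4 h5
          · rcases h3.eq_or_lt with rfl | h7
            · exact hk.not_rel x (by omega) h2 (P.symm h5)
            · omega
      · exact hσ.restrict _ _
      · exact restrictInterval_mono hle
      · refine Prod.ext ?_ ?_
        · refine glue_restrict hP hk1 hk2 ⟨fun h => ⟨h, hk.rel h⟩, fun h => h.1⟩ ?_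
          intro x l _ _ hkl hl _
          exact hk.rel (by omega)
        · refine glue_restrict hσ hk1 hk2 ⟨fun h => ⟨h, hle (hk.rel h)⟩, fun h => h.1⟩ ?_
          intro x l _ _ hkl hl _
          exact hle (hk.rel (by omega))
    · rintro ⟨i, hi, x, ⟨hx1, hx2, hx3⟩, y, ⟨hy1, hy2, hy3⟩, h⟩
      rw [Finset.mem_range] at hi
      obtain ⟨rfl, rfl⟩ := Prod.mk.inj h
      exact ⟨IsNoncrossing.glue (hx1.mono (Nat.le_succ a) le_rfl) hy1 (by omega) (by omega) id,
        IsNoncrossing.glue hx2 hy2 (by omega) (by omega) id, glue_mono id hx3 hy3⟩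
  · intro i hi i' hi' x hx y hy x' hx' y' hy' h
    rw [Finset.mem_range] at hi hi'
    obtain ⟨h1, h2⟩ := Prod.mk.inj h
    have hn := isNextInClass_glue (a := a) (b := b) (r₂ := y.1) hx.1 (by omega) (by omega)
    have hn' := isNextInClass_glue (a := a) (b := b) (r₂ := y'.1) hx'.1 (by omega) (by omega)
    rw [← h1] at hn'
    have he := hn.unique hn'
    obtain rfl : i = i' := by omega
    refine ⟨rfl, Prod.ext ?_ ?_, Prod.ext ?_ ?_⟩
    · rw [← restrict_glue_left (hx.1.mono (Nat.le_succ a) le_rfl), h1,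
        restrict_glue_left (hx'.1.mono (Nat.le_succ a) le_rfl)]
    · rw [← restrict_glue_left hx.2.1, h2, restrict_glue_left hx'.2.1]
    · rw [← restrict_glue_right hy.1, h1, restrict_glue_right hy'.1]
    · rw [← restrict_glue_right hy.2.1, h2, restrict_glue_right hy'.2.1]

/-! ### The closed formula for ternary trees. -/

/-- The number of ternary trees with `n` inner nodes. -/
def ternaryCount : ℕ → ℕ
  | 0 => 1
  | n + 1 => ∑ i : Fin (n + 1),
      (∑ s : Fin (i + 1), ternaryCount s * ternaryCount (i - s)) * ternaryCount (n - i)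

theorem ternaryCount_succ (n : ℕ) : ternaryCount (n + 1) = ∑ i ∈ Finset.range (n + 1),
    (∑ s ∈ Finset.range (i + 1), ternaryCount s * ternaryCount (i - s)) * ternaryCount (n - i) := by
  rw [ternaryCount, Finset.sum_range]
  refine Finset.sum_congr rfl fun i _ => ?_
  rw [Finset.sum_range]

theorem encard_noncrossingPairs (n a : ℕ) :
    (noncrossingPairs a (a + n)).encard = ternaryCount n := by
  induction n using Nat.strong_induction_on generalizing a with
  | _ n ih =>
    cases n with
    | zero =>
      rw [ternaryCount, Nat.cast_one, Set.encard_eq_one]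
      refine ⟨(⊥, ⊥), ?_⟩
      have hbot : ∀ r : Setoid ℕ, IsNoncrossing a (a + 0) r ↔ r = ⊥ := by
        intro r
        constructor
        · intro h
          ext i j
          rw [Setoid.bot_def]
          refine ⟨fun hij => ?_, fun hij => hij ▸ r.refl _⟩
          have := h.supp _ _ hij
          omega
        · rintro rfl
          refine ⟨fun i j h => Or.inl h, fun i j k l hij hjk _ hik _ => ?_⟩
          have : i = k := hik
          omega
      ext ⟨P, σ⟩
      simp only [noncrossingPairs, Set.mem_ofPred_eq, hbot, Set.mem_singleton_iff, Prod.mk.injEq]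
      constructor
      · exact fun h => ⟨h.1, h.2.1⟩
      · rintro ⟨rfl, rfl⟩
        exact ⟨rfl, rfl, le_rfl⟩
    | succ n =>
      rw [ternaryCount_succ]
      exact encard_noncrossingPairs_succ ternaryCount fun m hm c => ih m (by omega) c

-- From B = 1 + X B³ follows B^(r+1) = B^r + X B^(r+3). Induction on n, and inside it on r, then
-- gives (3n + r) [Xⁿ] B^r = r · binom(3n + r, n) for all powers at once; r = 1 is what is needed.
open PowerSeries in
theorem ternaryCount_formula (n : ℕ) :
    (2 * n + 1) * ternaryCount n = (3 * n).choose n := by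
  set B : PowerSeries ℕ := PowerSeries.mk ternaryCount with hB
  have hB3 : B = 1 + X * B ^ 3 := by
    ext n
    cases n with
    | zero => simp [hB, ternaryCount]
    | succ n =>
      rw [map_add, coeff_succ_X_mul, coeff_one, if_neg n.succ_ne_zero, zero_add, hB, coeff_mk,
        ternaryCount_succ, pow_succ, pow_two, coeff_mul,
        Finset.Nat.sum_antidiagonal_eq_sum_range_succ_mk]
      refine Finset.sum_congr rfl fun i _ => ?_
      rw [coeff_mul, coeff_mk, Finset.Nat.sum_antidiagonal_eq_sum_range_succ_mk]
      simp only [coeff_mk]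
  have hrec : ∀ r n, coeff (n + 1) (B ^ (r + 1)) =
      coeff (n + 1) (B ^ r) + coeff n (B ^ (r + 3)) := by
    intro r n
    have h : B ^ (r + 1) = B ^ r + X * B ^ (r + 3) := by
      calc B ^ (r + 1) = B ^ r * B := pow_succ _ _
        _ = B ^ r * (1 + X * B ^ 3) := by rw [← hB3]
        _ = _ := by ring
    rw [h, map_add, coeff_succ_X_mul]
  have hzero : ∀ r, coeff 0 (B ^ r) = 1 := by
    intro r
    rw [coeff_zero_eq_constantCoeff, map_pow, ← coeff_zero_eq_constantCoeff_apply, hB, coeff_mk,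
      ternaryCount, one_pow]
  have hmain : ∀ n r, (3 * n + r) * coeff n (B ^ r) = r * (3 * n + r).choose n := by
    intro n
    induction n with
    | zero =>
      intro r
      rw [hzero]
      simp
    | succ n ih =>
      intro r
      induction r with
      | zero => simp [coeff_one]
      | succ r ihr =>
        rw [hrec]
        have h1 := ih (r + 3)
        rw [show 3 * n + (r + 3) = 3 * (n + 1) + r by ring] at h1
        set N := 3 * (n + 1) + r with hN
        have hNpos : 0 < N := by omega
        have e2 := Nat.choose_succ_right_eq N n
        have e3 : (N + 1).choose (n + 1) = N.choose n + N.choose (n + 1) := Nat.choose_succ_succ _ _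
        rw [show 3 * (n + 1) + (r + 1) = N + 1 by omega, e3]
        have e2' : N.choose (n + 1) * (n + 1) = N.choose n * (2 * n + 3 + r) := by
          rw [e2]
          congr 1
          omega
        apply Nat.eq_of_mul_eq_mul_left hNpos
        have hz : ((n : ℤ) + 1) ≠ 0 := by positivity
        zify at h1 ihr e2' ⊢
        apply mul_left_cancel₀ hz
        have hN' : (N : ℤ) = 3 * n + 3 + r := by rw [hN]; push_cast; ring
        linear_combination ((n : ℤ) + 1) * (N + 1) * ihr + ((n : ℤ) + 1) * (N + 1) * h1 +
          (r * (N + 1) - N * (r + 1)) * e2' + ((N.choose n : ℤ) * (-1 - r)) * hN'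
  have h := hmain n 1
  rw [pow_one, hB, coeff_mk, one_mul] at h
  -- This trades binom(3n + 1, n) for binom(3n, n).
  have h4 := Nat.choose_mul_succ_eq (3 * n) n
  have h5 : 3 * n + 1 - n = 2 * n + 1 := by omega
  rw [h5] at h4
  apply Nat.eq_of_mul_eq_mul_left (show 0 < 3 * n + 1 by omega)
  calc (3 * n + 1) * ((2 * n + 1) * ternaryCount n)
      = (2 * n + 1) * ((3 * n + 1) * ternaryCount n) := by ring
    _ = (3 * n).choose n * (3 * n + 1) := by rw [h, h4]; ring
    _ = _ := by ring

/-! ### Interleaved sequences and counting over a period. -/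

/-- The sequence `x₀, y₀, x₁, y₁, …`. -/
def interleave {β : Type*} (x y : ℕ → β) (t : ℕ) : β := if Even t then x (t / 2) else y (t / 2)

theorem interleave_two_mul {β : Type*} (x y : ℕ → β) (i : ℕ) : interleave x y (2 * i) = x i := by
  rw [interleave, if_pos (even_two_mul i), Nat.mul_div_cancel_left _ two_pos]

theorem interleave_two_mul_add_one {β : Type*} (x y : ℕ → β) (i : ℕ) :
    interleave x y (2 * i + 1) = y i := by
  rw [interleave, if_neg (Nat.not_even_iff_odd.2 (odd_two_mul_add_one i))]
  congr 1
  omega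

theorem interleave_two_mul_add_two {β : Type*} (x y : ℕ → β) (i : ℕ) :
    interleave x y (2 * i + 1 + 1) = x (i + 1) := interleave_two_mul x y (i + 1)

theorem interleave_closed {β : Type*} {q : ℕ} {x y : ℕ → β} (hx : ∀ i, x (i + q) = x i) :
    interleave x y (2 * q) = interleave x y 0 := by
  rw [interleave_two_mul, show (0 : ℕ) = 2 * 0 from rfl, interleave_two_mul, ← hx 0, zero_add]

theorem interleave_ne {β : Type*} {x y : ℕ → β} (hxy : ∀ i, x i ≠ y i) (hyx : ∀ i, y i ≠ x
    (i + 1)) (t : ℕ) :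
    interleave x y t ≠ interleave x y (t + 1) := by
  obtain ⟨k, rfl | rfl⟩ := t.even_or_odd'
  · rw [interleave_two_mul, interleave_two_mul_add_one]
    exact hxy k
  · rw [interleave_two_mul_add_one, interleave_two_mul_add_two]
    exact hyx k

theorem card_filter_interleave {β : Type*} [DecidableEq β] (x y : ℕ → β) (q : ℕ) (e : Sym2 β) :
    ((Finset.range (2 * q)).filter
      fun t => s(interleave x y t, interleave x y (t + 1)) = e).card =
    ∑ i ∈ Finset.range q, ((if s(x i, y i) = e then 1 else 0) +
      if s(y i, x (i + 1)) = e then 1 else 0) := by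
  rw [Finset.card_filter]
  induction q with
  | zero => simp
  | succ q ih =>
    rw [show 2 * (q + 1) = 2 * q + 1 + 1 by ring, Finset.sum_range_succ, Finset.sum_range_succ, ih,
      Finset.sum_range_succ, interleave_two_mul, interleave_two_mul_add_one,
      interleave_two_mul_add_two, add_assoc]

theorem exists_mem_Ioc_of_periodic {p : ℕ → Prop} {T : ℕ} (hT : 0 < T) (hp : Function.Periodic p T)
    {n : ℕ} (hn : p n) (c : ℕ) : ∃ m ∈ Finset.Ioc c (c + T), p m := by
  induction c with
  | zero =>
    refine ⟨n % T + T * (if n % T = 0 then 1 else 0), ?_, ?_⟩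
    · rw [Finset.mem_Ioc]
      have := Nat.mod_lt n hT
      split_ifs <;> omega
    · split_ifs
      · rw [mul_one, hp, hp.map_mod_nat]
        exact hn
      · rw [mul_zero, add_zero, hp.map_mod_nat]
        exact hn
  | succ c ih =>
    obtain ⟨m, hm, hpm⟩ := ih
    rw [Finset.mem_Ioc] at hm
    by_cases h : m = c + 1
    · refine ⟨m + T, Finset.mem_Ioc.2 (by omega), ?_⟩
      rw [hp]
      exact hpm
    · exact ⟨m, Finset.mem_Ioc.2 (by omega), hpm⟩

theorem card_filter_Ioc_of_periodic {p : ℕ → Prop} [DecidablePred p] {q : ℕ}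
    (hp : Function.Periodic p (4 * q)) (c : ℕ) :
    ((Finset.Ioc c (c + 4 * q)).filter p).card =
      ∑ i ∈ Finset.range q, ((if p (4 * i) then 1 else 0) + (if p (4 * i + 1) then 1 else 0) +
        (if p (4 * i + 2) then 1 else 0) + if p (4 * i + 3) then 1 else 0) := by
  have h1 : Finset.Ioc c (c + 4 * q) = Finset.Ico (c + 1) (c + 1 + 4 * q) := by
    ext n
    rw [Finset.mem_Ioc, Finset.mem_Ico]
    omega
  rw [h1, Nat.filter_Ico_card_eq_of_periodic _ _ _ hp, Nat.count_eq_card_filter_range,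
    Finset.card_filter]
  clear hp h1
  induction q with
  | zero => simp
  | succ q ih =>
    rw [show 4 * (q + 1) = 4 * q + 1 + 1 + 1 + 1 by ring, Finset.sum_range_succ,
      Finset.sum_range_succ, Finset.sum_range_succ, Finset.sum_range_succ, ih,
      Finset.sum_range_succ]
    ring

/-! ### Even contractions: the bound `2 * q + 2` and the case of equality. -/

/-- The images of the vertices `x i = a_{i1}`, `z i = a_{i2}`, `y i = b_{i1}`, `w i = b_{i2}` of
`H(α_Z, 2q)` under a contraction without loops for which every edge has even multiplicity. -/
structure IsEvenZCycle {β : Type*} [DecidableEq β] (q : ℕ) (x y z w : ℕ → β) : Prop where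
  pos : 0 < q
  per_x : ∀ i, x (i + q) = x i
  per_y : ∀ i, y (i + q) = y i
  per_z : ∀ i, z (i + q) = z i
  per_w : ∀ i, w (i + q) = w i
  xz : ∀ i, x i ≠ z i
  yw : ∀ i, y i ≠ w i
  xy : ∀ i, x i ≠ y i
  yx : ∀ i, y i ≠ x (i + 1)
  zw : ∀ i, z i ≠ w i
  wz : ∀ i, w i ≠ z (i + 1)
  surj : ∀ b, ∃ i, b = x i ∨ b = y i ∨ b = z i ∨ b = w i
  even : ∀ e, Even (
    ∑ i ∈ Finset.range q, ((if s(x i, y i) = e then 1 else 0) +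
      if s(y i, x (i + 1)) = e then 1 else 0) +
    ∑ i ∈ Finset.range q, ((if s(z i, w i) = e then 1 else 0) +
      if s(w i, z (i + 1)) = e then 1 else 0) +
    ∑ i ∈ Finset.range q, ((if s(z i, y i) = e then 1 else 0) +
      if s(y i, z (i + 1)) = e then 1 else 0))

namespace IsEvenZCycle

variable {β : Type*} {q : ℕ} {x y z w : ℕ → β}

/-- The vertices in the order in which two walkers enter them that proceed in turn along
`y₀, x₁, y₁, …` and `w₀, z₁, w₁, …`. -/
def entered (x y z w : ℕ → β) (n : ℕ) : β :=
  if n % 4 = 0 then y (n / 4) else if n % 4 = 1 then w (n / 4)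
  else if n % 4 = 2 then z (n / 4 + 1) else x (n / 4 + 1)

/-- The vertex left by the walker that enters `entered x y z w n`. -/
def left (x y z w : ℕ → β) (n : ℕ) : β :=
  if n % 4 = 0 then x (n / 4) else if n % 4 = 1 then z (n / 4)
  else if n % 4 = 2 then w (n / 4) else y (n / 4)

/-- The position of the other walker when `entered x y z w n` is entered, for even `n`. -/
def other (y z : ℕ → β) (n : ℕ) : β := if n % 4 = 0 then z (n / 4) else y (n / 4)

theorem entered_mul {i : ℕ} : entered x y z w (4 * i) = y i ∧
    entered x y z w (4 * i + 1) = w i ∧ entered x y z w (4 * i + 2) = z (i + 1) ∧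
    entered x y z w (4 * i + 3) = x (i + 1) := by
  have h1 : (4 * i) % 4 = 0 := by omega
  have h2 : (4 * i + 1) % 4 = 1 := by omega
  have h3 : (4 * i + 2) % 4 = 2 := by omega
  have h4 : (4 * i + 3) % 4 = 3 := by omega
  have g1 : (4 * i) / 4 = i := by omega
  have g2 : (4 * i + 1) / 4 = i := by omega
  have g3 : (4 * i + 2) / 4 = i := by omega
  have g4 : (4 * i + 3) / 4 = i := by omega
  simp [entered, h2, h3, h4, g2, g3, g4]

theorem left_mul {i : ℕ} : left x y z w (4 * i) = x i ∧
    left x y z w (4 * i + 1) = z i ∧ left x y z w (4 * i + 2) = w i ∧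
    left x y z w (4 * i + 3) = y i := by
  have h2 : (4 * i + 1) % 4 = 1 := by omega
  have h3 : (4 * i + 2) % 4 = 2 := by omega
  have h4 : (4 * i + 3) % 4 = 3 := by omega
  have g2 : (4 * i + 1) / 4 = i := by omega
  have g3 : (4 * i + 2) / 4 = i := by omega
  have g4 : (4 * i + 3) / 4 = i := by omega
  simp [left, h2, h3, h4, g2, g3, g4]

theorem other_mul {i : ℕ} : other y z (4 * i) = z i ∧ other y z (4 * i + 2) = y i := by
  have h3 : (4 * i + 2) % 4 = 2 := by omega
  have g3 : (4 * i + 2) / 4 = i := by omega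
  simp [other, h3, g3]

theorem entered_stepSource {n : ℕ} (hn : 4 ≤ n) :
    entered x y z w (stepSource n) = left x y z w n := by
  obtain ⟨k, hk | hk | hk | hk⟩ : ∃ k, n = 4 * (k + 1) ∨ n = 4 * (k + 1) + 1 ∨
      n = 4 * (k + 1) + 2 ∨ n = 4 * (k + 1) + 3 := ⟨n / 4 - 1, by omega⟩
  · have hs : stepSource n = 4 * k + 3 := by
      rw [stepSource, if_pos (by rw [Nat.even_iff]; omega)]
      omega
    rw [hs, hk, left_mul.1, entered_mul.2.2.2]
  · have hs : stepSource n = 4 * k + 2 := by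
      rw [stepSource, if_neg (by rw [Nat.even_iff]; omega)]
      omega
    rw [hs, hk, left_mul.2.1, entered_mul.2.2.1]
  · have hs : stepSource n = 4 * (k + 1) + 1 := by
      rw [stepSource, if_pos (by rw [Nat.even_iff]; omega)]
      omega
    rw [hs, hk, left_mul.2.2.1, entered_mul.2.1]
  · have hs : stepSource n = 4 * (k + 1) := by
      rw [stepSource, if_neg (by rw [Nat.even_iff]; omega)]
      omega
    rw [hs, hk, left_mul.2.2.2, entered_mul.1]

theorem entered_sub_two {n : ℕ} (hn : 4 ≤ n) (he : Even n) :
    entered x y z w (n - 2) = other y z n := by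
  rw [Nat.even_iff] at he
  obtain ⟨k, hk | hk⟩ : ∃ k, n = 4 * (k + 1) ∨ n = 4 * (k + 1) + 2 := ⟨n / 4 - 1, by omega⟩
  · rw [hk, show 4 * (k + 1) - 2 = 4 * k + 2 by omega, entered_mul.2.2.1, other_mul.1]
  · rw [hk, show 4 * (k + 1) + 2 - 2 = 4 * (k + 1) by omega, entered_mul.1, other_mul.2]

theorem div_mod_add (q n : ℕ) : (n + 4 * q) % 4 = n % 4 ∧ (n + 4 * q) / 4 = n / 4 + q := by
  omega

variable [DecidableEq β]

theorem entered_periodic (h : IsEvenZCycle q x y z w) :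
    Function.Periodic (entered x y z w) (4 * q) := by
  intro n
  obtain ⟨h1, h2⟩ := div_mod_add q n
  unfold entered
  rw [h1, h2, h.per_y, h.per_w, add_right_comm, h.per_z, h.per_x]

theorem left_periodic (h : IsEvenZCycle q x y z w) :
    Function.Periodic (left x y z w) (4 * q) := by
  intro n
  obtain ⟨h1, h2⟩ := div_mod_add q n
  unfold left
  rw [h1, h2, h.per_y, h.per_w, h.per_z, h.per_x]

theorem other_periodic (h : IsEvenZCycle q x y z w) :
    Function.Periodic (other y z) (4 * q) := by
  intro n
  obtain ⟨h1, h2⟩ := div_mod_add q n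
  unfold other
  rw [h1, h2, h.per_y, h.per_z]

/-- The window starts when the two walkers stand at the ends of the coinciding cross edge. -/
theorem card_lt_of_left_eq_other (h : IsEvenZCycle q x y z w) [Fintype β] {n c : ℕ}
    (hc : Even c)
    (hn : s(left x y z w n, entered x y z w n) = s(other y z c, entered x y z w c)) :
    Fintype.card β < 2 * q + 2 := by
  have hq := h.pos
  have pe := h.entered_periodic
  have pl := h.left_periodic
  have po := h.other_periodic
  -- Shifting by a period keeps the subtractions in `stepSource` from truncating.
  set c' := c + 4 * q with hc'
  have hc4 : 4 ≤ c' := by omega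
  have hce : Even c' := hc.add (by rw [Nat.even_iff]; omega)
  have hpS : ∀ e, Function.Periodic (fun n => s(left x y z w n, entered x y z w n) = e) (4 * q) :=
    fun e n => by simp only [pl n, pe n]
  have hpK : ∀ e, Function.Periodic
      (fun n => Even n ∧ s(other y z n, entered x y z w n) = e) (4 * q) := fun e n => by
    simp only [po n, pe n]
    have : Even (n + 4 * q) ↔ Even n := by
      rw [Nat.even_iff, Nat.even_iff]
      omega
    rw [this]
  refine card_lt_of_step_eq_cross (entered x y z w) (c := c') hce hc4 ?_ (pe c') ?_ ?_ ?_ ?_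
  · intro b
    have hper : Function.Periodic (fun n => entered x y z w n = b) (4 * q) := fun n => by
      simp only [pe n]
    obtain ⟨i, hi⟩ := h.surj b
    suffices ∃ n, entered x y z w n = b by
      obtain ⟨n, hn⟩ := this
      exact exists_mem_Ioc_of_periodic (by omega) hper hn c'
    rcases hi with rfl | rfl | rfl | rfl
    · refine ⟨4 * (i + q - 1) + 3, ?_⟩
      rw [entered_mul.2.2.2, show i + q - 1 + 1 = i + q by omega, h.per_x]
    · exact ⟨_, entered_mul.1⟩
    · refine ⟨4 * (i + q - 1) + 2, ?_⟩
      rw [entered_mul.2.2.1, show i + q - 1 + 1 = i + q by omega, h.per_z]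
    · exact ⟨_, entered_mul.2.1⟩
  · rw [show c' + 4 * q - 2 = c' - 2 + 4 * q by omega, pe]
  · intro m hm
    rw [Nat.even_iff] at hm
    obtain ⟨k, hk | hk⟩ : ∃ k, m = 4 * k ∨ m = 4 * k + 2 := ⟨m / 4, by omega⟩
    · rw [hk, entered_mul.1, entered_mul.2.1]
      exact h.yw k
    · rw [hk, entered_mul.2.2.1, entered_mul.2.2.2]
      exact (h.xz (k + 1)).symm
  · intro e
    have hS : (Finset.Ioc c' (c' + 4 * q)).filter
          (fun n => s(entered x y z w (stepSource n), entered x y z w n) = e) =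
        (Finset.Ioc c' (c' + 4 * q)).filter
          fun n => s(left x y z w n, entered x y z w n) = e := by
      refine Finset.filter_congr fun m hm => ?_
      rw [Finset.mem_Ioc] at hm
      rw [entered_stepSource (by omega)]
    have hK : (Finset.Ioc c' (c' + 4 * q)).filter
          (fun n => Even n ∧ s(entered x y z w (n - 2), entered x y z w n) = e) =
        (Finset.Ioc c' (c' + 4 * q)).filter
          fun n => Even n ∧ s(other y z n, entered x y z w n) = e := by
      refine Finset.filter_congr fun m hm => ?_
      rw [Finset.mem_Ioc] at hm
      refine and_congr_right fun hme => ?_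
      rw [entered_sub_two (by omega) hme]
    rw [hS, hK, card_filter_Ioc_of_periodic (hpS e), card_filter_Ioc_of_periodic (hpK e)]
    have h0 : ∀ i : ℕ, Even (4 * i) := fun i => by rw [Nat.even_iff]; omega
    have h1 : ∀ i : ℕ, ¬ Even (4 * i + 1) := fun i => by rw [Nat.even_iff]; omega
    have h2 : ∀ i : ℕ, Even (4 * i + 2) := fun i => by rw [Nat.even_iff]; omega
    have h3 : ∀ i : ℕ, ¬ Even (4 * i + 3) := fun i => by rw [Nat.even_iff]; omega
    simp only [entered_mul, left_mul, other_mul, h0, h1, h2, h3, true_and, false_and, if_false,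
      add_zero]
    have := h.even e
    rw [← Finset.sum_add_distrib] at this
    convert this using 3
    ring
  · rw [entered_sub_two hc4 hce, po, pe]
    obtain ⟨m, hm, hme⟩ := exists_mem_Ioc_of_periodic (by omega) (hpS _) hn c'
    refine ⟨m, hm, ?_⟩
    rw [Finset.mem_Ioc] at hm
    rw [entered_stepSource (by omega)]
    exact hme

end IsEvenZCycle

namespace IsEvenZCycle

variable {β : Type*} [DecidableEq β] {q : ℕ} {x y z w : ℕ → β}

/-- A given `e` is never a step or never a cross edge, so its parity condition concerns one kind
only. -/
theorem even_of_no_coincidence (h : IsEvenZCycle q x y z w)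
    (hno : ¬ ∃ n c, Even c ∧ s(left x y z w n, entered x y z w n) =
      s(other y z c, entered x y z w c)) (e : Sym2 β) :
    Even (((Finset.range (2 * q)).filter
        fun t => s(interleave x y t, interleave x y (t + 1)) = e).card +
      ((Finset.range (2 * q)).filter
        fun t => s(interleave z w t, interleave z w (t + 1)) = e).card) ∧
    Even (∑ i ∈ Finset.range q, ((if s(z i, y i) = e then 1 else 0) +
      if s(y i, z (i + 1)) = e then 1 else 0)) := by
  have heven := h.even e
  rw [← card_filter_interleave, ← card_filter_interleave] at heven
  suffices hor : ((Finset.range (2 * q)).filter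
        fun t => s(interleave x y t, interleave x y (t + 1)) = e).card +
      ((Finset.range (2 * q)).filter
        fun t => s(interleave z w t, interleave z w (t + 1)) = e).card = 0 ∨
      (∑ i ∈ Finset.range q, ((if s(z i, y i) = e then 1 else 0) +
        if s(y i, z (i + 1)) = e then 1 else 0)) = 0 by
    rcases hor with h0 | h0
    · rw [h0] at heven ⊢
      rw [zero_add] at heven
      exact ⟨Even.zero, heven⟩
    · rw [h0] at heven ⊢
      exact ⟨heven, Even.zero⟩
  by_cases hc : ∃ c, Even c ∧ s(other y z c, entered x y z w c) = e
  · left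
    obtain ⟨c, hc, hce⟩ := hc
    have hn : ∀ n, s(left x y z w n, entered x y z w n) ≠ e := fun n hn =>
      hno ⟨n, c, hc, hn.trans hce.symm⟩
    rw [card_filter_interleave, card_filter_interleave, ← Finset.sum_add_distrib]
    refine Finset.sum_eq_zero fun i _ => ?_
    have h1 := hn (4 * i)
    have h2 := hn (4 * i + 1)
    have h3 := hn (4 * i + 2)
    have h4 := hn (4 * i + 3)
    simp only [entered_mul, left_mul] at h1 h2 h3 h4
    simp only [if_neg h1, if_neg h2, if_neg h3, if_neg h4, add_zero]
  · right
    push Not at hc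
    refine Finset.sum_eq_zero fun i _ => ?_
    have h1 := hc (4 * i) (by rw [Nat.even_iff]; omega)
    have h2 := hc (4 * i + 2) (by rw [Nat.even_iff]; omega)
    simp only [entered_mul, other_mul] at h1 h2
    simp only [if_neg h1, if_neg h2, add_zero]

theorem image_union_image (h : IsEvenZCycle q x y z w) [Fintype β] :
    (Finset.range (2 * q)).image (interleave x y) ∪ (Finset.range (2 * q)).image (interleave z w) =
      Finset.univ := by
  refine Finset.eq_univ_of_forall fun b => ?_
  obtain ⟨i, hi⟩ := h.surj b
  have hlt := Nat.mod_lt i h.pos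
  have hmod : ∀ f : ℕ → β, (∀ i, f (i + q) = f i) → f (i % q) = f i := fun f hf =>
    Function.Periodic.map_mod_nat hf i
  rw [Finset.mem_union, Finset.mem_image, Finset.mem_image]
  rcases hi with rfl | rfl | rfl | rfl
  · exact Or.inl ⟨2 * (i % q), Finset.mem_range.2 (by omega),
      by rw [interleave_two_mul, hmod x h.per_x]⟩
  · exact Or.inl ⟨2 * (i % q) + 1, Finset.mem_range.2 (by omega),
      by rw [interleave_two_mul_add_one, hmod y h.per_y]⟩
  · exact Or.inr ⟨2 * (i % q), Finset.mem_range.2 (by omega),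
      by rw [interleave_two_mul, hmod z h.per_z]⟩
  · exact Or.inr ⟨2 * (i % q) + 1, Finset.mem_range.2 (by omega),
      by rw [interleave_two_mul_add_one, hmod w h.per_w]⟩

theorem card_le (h : IsEvenZCycle q x y z w) [Fintype β] : Fintype.card β ≤ 2 * q + 2 := by
  by_cases hno : ∃ n c, Even c ∧ s(left x y z w n, entered x y z w n) =
      s(other y z c, entered x y z w c)
  · obtain ⟨n, c, hc, hn⟩ := hno
    exact (h.card_lt_of_left_eq_other hc hn).le
  · have := (card_union_of_even_steps _ _ (interleave_closed h.per_x) (interleave_closed h.per_z)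
      fun e => (h.even_of_no_coincidence hno e).1).1
    rwa [h.image_union_image, Finset.card_univ] at this

/-- The structure of contractions with the largest possible number of vertices. -/
theorem structure_of_card_eq (h : IsEvenZCycle q x y z w) [Fintype β]
    (hcard : Fintype.card β = 2 * q + 2) :
    IsTreeWalk q (interleave x y) ∧ IsTreeWalk q (interleave z w) ∧
    (∀ s < 2 * q, ∀ t < 2 * q, interleave x y s ≠ interleave z w t) ∧
    ∀ i j, i ≤ j → j < q → x i = x j → z i = z j := by
  have hno : ¬ ∃ n c, Even c ∧ s(left x y z w n, entered x y z w n) =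
      s(other y z c, entered x y z w c) := by
    rintro ⟨n, c, hc, hn⟩
    have := h.card_lt_of_left_eq_other hc hn
    omega
  obtain ⟨hdisj, hc1, hc2, he1, he2⟩ := (card_union_of_even_steps _ _ (interleave_closed h.per_x)
    (interleave_closed h.per_z) fun e => (h.even_of_no_coincidence hno e).1).2
      (by rw [h.image_union_image, Finset.card_univ, hcard])
  have hT : IsTreeWalk q (interleave x y) :=
    ⟨interleave_closed h.per_x, he1, hc1, fun t _ => interleave_ne h.xy h.yx t⟩
  refine ⟨hT, ⟨interleave_closed h.per_z, he2, hc2, fun t _ => interleave_ne h.zw h.wz t⟩, hdisj,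
    fun i j hij hj hx => ?_⟩
  -- Since the walks are disjoint, an unordered cross edge determines which end is its `y` and which
  -- its `z`.
  have hyz : ∀ k < q, ∀ m, y k ≠ z m := by
    intro k hk m hkm
    have := hdisj (2 * k + 1) (by omega) (2 * (m % q)) (by have := Nat.mod_lt m h.pos; omega)
    rw [interleave_two_mul, interleave_two_mul_add_one,
      Function.Periodic.map_mod_nat (f := z) h.per_z] at this
    exact this hkm
  refine hT.eq_of_even_cross z (fun e a => ?_) hij hj.le
    (by rw [interleave_two_mul, interleave_two_mul, hx])
  simp only [interleave_two_mul_add_one]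
  by_cases he : ∃ k < q, y k = e
  · obtain ⟨k, hk, rfl⟩ := he
    have := (h.even_of_no_coincidence hno s(a, y k)).2
    rw [Finset.sum_add_distrib] at this
    rw [Finset.card_filter, Finset.card_filter]
    have key : ∀ m n, s(z n, y m) = s(a, y k) ↔ y m = y k ∧ z n = a := by
      intro m n
      rw [Sym2.eq_iff]
      constructor
      · rintro (⟨h1, h2⟩ | ⟨h1, -⟩)
        · exact ⟨h2, h1⟩
        · exact absurd h1.symm (hyz k hk n)
      · exact fun h => Or.inl ⟨h.2, h.1⟩
    simp only [Sym2.eq_swap (a := y _) (b := z _), key] at this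
    exact this
  · push Not at he
    rw [Finset.filter_eq_empty_iff.2, Finset.filter_eq_empty_iff.2]
    · simp
    · exact fun m hm h' => he m (Finset.mem_range.1 hm) h'.1
    · exact fun m hm h' => he m (Finset.mem_range.1 hm) h'.1

end IsEvenZCycle

/-! ### Kreweras complements and the closed walks they define. -/

/-- The Kreweras complement: `i` and `j` are related if no class of `r` has members both in and
outside of the interval between `i` and `j`. -/
def kreweras (r : Setoid ℕ) : Setoid ℕ where
  r i j := ∀ a b, r a b → ((i < a ↔ j < a) ↔ (i < b ↔ j < b))
  iseqv := by
    refine ⟨fun i a b _ => by simp, fun {i j} h a b hab => ?_, fun {i j k} h h' a b hab => ?_⟩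
    · have := h a b hab
      tauto
    · have h1 := h a b hab
      have h2 := h' a b hab
      tauto

theorem kreweras_apply {r : Setoid ℕ} {i j : ℕ} :
    kreweras r i j ↔ ∀ a b, r a b → ((i < a ↔ j < a) ↔ (i < b ↔ j < b)) := Iff.rfl

theorem kreweras_iff_of_le {r : Setoid ℕ} {i j : ℕ} (hij : i ≤ j) :
    kreweras r i j ↔ ∀ a b, r a b → (i < a ∧ a ≤ j) → (i < b ∧ b ≤ j) := by
  have key : ∀ a, (i < a ↔ j < a) ↔ ¬ (i < a ∧ a ≤ j) := fun a => by omega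
  rw [kreweras_apply]
  simp only [key]
  constructor
  · intro h a b hab ha
    exact not_not.1 (fun hb => (h a b hab).2 hb ha)
  · intro h a b hab
    exact not_congr ⟨h a b hab, h b a (r.symm hab)⟩

/-- The first members of the classes of `r` and the last members of the classes of its Kreweras
complement are together more than `q`. -/
theorem card_first_add_card_last (r : Setoid ℕ) {q : ℕ} (hq : 0 < q) :
    ∃ F L : Finset ℕ, F ⊆ Finset.range q ∧ L ⊆ Finset.range q ∧ q + 1 ≤ F.card + L.card ∧
      (∀ i ∈ F, ∀ j ∈ F, r i j → i = j) ∧ (∀ i ∈ L, ∀ j ∈ L, kreweras r i j → i = j) := by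
  classical
  set F := (Finset.range q).filter fun i => ∀ k < i, ¬ r k i with hF
  set L := (Finset.range q).filter fun i => ∀ k, i < k → k < q → ¬ kreweras r i k with hL
  refine ⟨F, L, Finset.filter_subset _ _, Finset.filter_subset _ _, ?_, ?_, ?_⟩
  · have hsub : Finset.range (q + 1) ⊆ F ∪ L.image (· + 1) := by
      intro i hi
      rw [Finset.mem_range] at hi
      rw [Finset.mem_union, hF, Finset.mem_filter, Finset.mem_range, Finset.mem_image]
      by_cases hiF : i < q ∧ ∀ k < i, ¬ r k i
      · exact Or.inl hiF
      right
      have hi0 : 0 < i := by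
        by_contra h0
        exact hiF ⟨by omega, fun k hk => by omega⟩
      refine ⟨i - 1, ?_, by omega⟩
      rw [hL, Finset.mem_filter, Finset.mem_range]
      refine ⟨by omega, fun k hk hkq hkr => ?_⟩
      have hiq : i < q := by omega
      push Not at hiF
      obtain ⟨m, hm, hmi⟩ := hiF hiq
      clear hiF
      have := hkr m i hmi
      rw [iff_of_false (show ¬ i - 1 < m by omega) (show ¬ k < m by omega)] at this
      simp only [true_iff] at this
      have := this.1 (by omega)
      omega
    have h1 := Finset.card_le_card hsub
    have h2 := Finset.card_union_le F (L.image (· + 1))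
    have h3 : (L.image (· + 1)).card ≤ L.card := Finset.card_image_le
    rw [Finset.card_range] at h1
    omega
  · intro i hi j hj hij
    rw [hF, Finset.mem_filter] at hi hj
    by_contra hne
    rcases lt_or_gt_of_ne hne with h | h
    · exact hj.2 i h hij
    · exact hi.2 j h (r.symm hij)
  · intro i hi j hj hij
    rw [hL, Finset.mem_filter, Finset.mem_range] at hi hj
    by_contra hne
    rcases lt_or_gt_of_ne hne with h | h
    · exact hi.2 j h hj.1 hij
    · exact hj.2 i h hi.1 ((kreweras r).symm hij)

/-- In the closed walk given by a noncrossing partition and its Kreweras complement, the step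
leaving position `i` is retraced by the step entering the cyclically next member of its class. -/
theorem IsNoncrossing.exists_retrace {q : ℕ} {r : Setoid ℕ} (h : IsNoncrossing 0 q r) :
    ∃ ν : ℕ → ℕ, (∀ i < q, ν i < q) ∧ Set.InjOn ν (Finset.range q) ∧
      ∀ i < q, kreweras r (ν i) i ∧ r ((ν i + 1) % q) i := by
  classical
  have s : ∀ {x y}, r x y → r y x := r.symm
  have t : ∀ {x y z}, r x y → r y z → r x z := r.trans
  -- The final disjunction says that `(n + 1) % q` is the cyclic successor of `i` in its class; it
  -- serves the injectivity of `ν`.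
  have key : ∀ i < q, ∃ n < q, kreweras r n i ∧ r ((n + 1) % q) i ∧
      ((i < (n + 1) % q ∧ ∀ k, i < k → k < (n + 1) % q → ¬ r i k) ∨
        ((n + 1) % q ≤ i ∧ (∀ k, i < k → ¬ r i k) ∧ ∀ k < (n + 1) % q, ¬ r i k)) := by
    intro i hi
    obtain ⟨c, hc⟩ := exists_isNextInClass r hi
    have hic := hc.lt
    rcases hc.le.lt_or_eq with hcq | hcq
    · have hmod : (c - 1 + 1) % q = c := by
        rw [Nat.sub_add_cancel (by omega), Nat.mod_eq_of_lt hcq]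
      have hrc := hc.rel hcq
      refine ⟨c - 1, by omega, (kreweras r).symm ((kreweras_iff_of_le (by omega)).2 ?_), ?_,
        Or.inl ?_⟩
      · intro a b hab ha
        have hia : ¬ r i a := hc.not_rel a ha.1 (by omega)
        by_contra hb
        have hbi : b ≠ i := fun h' => hia (s (h' ▸ hab))
        have hbc : b ≠ c := fun h' => hia (t hrc (s (h' ▸ hab)))
        rcases lt_or_ge b i with h1 | h1
        · exact hia (t (s (h.nc b i a c h1 ha.1 (by omega) (s hab) hrc)) (s hab))
        · exact hia (h.nc i a c b ha.1 (by omega) (by omega) hrc hab)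
      · rw [hmod]
        exact s hrc
      · rw [hmod]
        exact ⟨hic, hc.not_rel⟩
    -- Here `i` is last in its class, so the successor is the first member `d`; for `d = 0` the
    -- position before it is `q - 1`.
    · have hex : ∃ k, r i k := ⟨i, r.refl _⟩
      obtain ⟨d, hrd, hdi, hmin⟩ : ∃ d, r i d ∧ d ≤ i ∧ ∀ k < d, ¬ r i k :=
        ⟨Nat.find hex, Nat.find_spec hex, Nat.find_min' hex (r.refl _),
          fun k hk => Nat.find_min hex hk⟩
      have hmax : ∀ k, i < k → ¬ r i k := fun k hk hik => by
        have := h.supp _ _ hik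
        exact hc.not_rel k hk (by omega) hik
      have hn : ∃ n < q, (n + 1) % q = d ∧ ((0 < d ∧ n + 1 = d) ∨ (d = 0 ∧ n + 1 = q)) := by
        rcases Nat.eq_zero_or_pos d with h0 | h0
        · refine ⟨q - 1, by omega, ?_, Or.inr ⟨h0, by omega⟩⟩
          rw [Nat.sub_add_cancel (by omega), Nat.mod_self, h0]
        · refine ⟨d - 1, by omega, ?_, Or.inl ⟨h0, by omega⟩⟩
          rw [Nat.sub_add_cancel (by omega), Nat.mod_eq_of_lt (by omega)]
      obtain ⟨n, hnq, hnd, hn⟩ := hn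
      refine ⟨n, hnq, ?_, ?_, Or.inr ?_⟩
      · have hmem : ∀ a < q, (n < a ↔ i < a) ↔ (0 < d ↔ ¬ (d ≤ a ∧ a ≤ i)) := by
          intro a ha
          rcases hn with ⟨h0, hn⟩ | ⟨h0, hn⟩
          · have h1 : n < a ↔ d ≤ a := by omega
            have h2 : a ≤ i ↔ ¬ i < a := not_lt.symm
            have h3 : i < a → d ≤ a := by omega
            simp only [h1, h2, h0, true_iff]
            tauto
          · have h1 : ¬ n < a := by omega
            have h2 : d ≤ a := by omega
            have h3 : ¬ 0 < d := by omega
            simp only [h1, h2, h3, false_iff, true_and, not_not, not_lt]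
        have hsat : ∀ a b, r a b → d ≤ a → a ≤ i → d ≤ b ∧ b ≤ i := by
          intro a b hab hda hai
          by_contra hb
          have hib : ¬ r i b := by
            rcases lt_or_ge b d with h1 | h1
            · exact hmin b h1
            · exact hmax b (by omega)
          rcases hda.eq_or_lt with h1 | h1
          · exact hib (t hrd (h1 ▸ hab))
          rcases hai.eq_or_lt with h2 | h2
          · exact hib (h2 ▸ hab)
          rcases lt_or_ge b d with h3 | h3
          · exact hib (t hrd (s (h.nc b d a i h3 h1 h2 (s hab) (s hrd))))
          · exact hib (t hrd (t (h.nc d a i b h1 h2 (by omega) (s hrd) hab) hab))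
        intro a b hab
        rcases h.supp _ _ hab with rfl | ⟨-, ha, -, hb⟩
        · rfl
        rw [hmem a ha, hmem b hb]
        exact iff_congr Iff.rfl <| not_congr ⟨fun h' => hsat a b hab h'.1 h'.2,
          fun h' => hsat b a (s hab) h'.1 h'.2⟩
      · rw [hnd]
        exact s hrd
      · rw [hnd]
        exact ⟨hdi, hmax, hmin⟩
  choose! ν h1 h2 h3 h4 using key
  refine ⟨ν, h1, ?_, fun i hi => ⟨h2 i hi, h3 i hi⟩⟩
  have hlt : ∀ i < q, ∀ j < q, i < j → ν i ≠ ν j := by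
    intro i hi j hj hij hν
    have hri := h3 i hi
    have hrj := h3 j hj
    rw [← hν] at hrj
    have hrij : r i j := t (s hri) hrj
    have h4i := h4 i hi
    have h4j := h4 j hj
    rw [← hν] at h4j
    rcases h4i with ⟨h5, h6⟩ | ⟨h5, h6, h7⟩
    · rcases h4j with ⟨h8, -⟩ | ⟨h8, -, h9⟩
      · exact h6 j hij h8 hrij
      · exact h9 i h5 (s hrij)
    · exact h6 j hij hrij
  intro i hi j hj hν
  rw [Finset.coe_range, Set.mem_Iio] at hi hj
  by_contra hne
  rcases lt_or_gt_of_ne hne with h' | h'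
  · exact hlt i hi j hj h' hν
  · exact hlt j hj i hi h' hν.symm

theorem sum_comp_of_injOn {q : ℕ} {ν : ℕ → ℕ} (hν : ∀ i < q, ν i < q)
    (hinj : Set.InjOn ν (Finset.range q)) (f : ℕ → ℕ) :
    ∑ i ∈ Finset.range q, f (ν i) = ∑ i ∈ Finset.range q, f i := by
  have himg : (Finset.range q).image ν = Finset.range q := by
    refine Finset.eq_of_subset_of_card_le ?_ ?_
    · intro n hn
      obtain ⟨i, hi, rfl⟩ := Finset.mem_image.1 hn
      exact Finset.mem_range.2 (hν i (Finset.mem_range.1 hi))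
    · rw [Finset.card_image_of_injOn hinj]
  conv_rhs => rw [← himg, Finset.sum_image hinj]

/-- The edge into `x (ν i + 1)` equals the edge out of `x i`, and `ν` permutes the indices, so both
kinds of edges are equally frequent. -/
theorem even_sum_of_retrace {β : Type*} [DecidableEq β] {q : ℕ} {ν : ℕ → ℕ} (hν : ∀ i < q, ν i < q)
    (hinj : Set.InjOn ν (Finset.range q)) {x y : ℕ → β}
    (hx : ∀ i < q, x (ν i + 1) = x i) (hy : ∀ i < q, y (ν i) = y i) (e : Sym2 β) :
    Even (∑ i ∈ Finset.range q, ((if s(x i, y i) = e then 1 else 0) +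
      if s(y i, x (i + 1)) = e then 1 else 0)) := by
  rw [Finset.sum_add_distrib,
    ← sum_comp_of_injOn hν hinj (fun i => if s(y i, x (i + 1)) = e then 1 else 0)]
  have : ∑ i ∈ Finset.range q, (if s(y (ν i), x (ν i + 1)) = e then 1 else 0) =
      ∑ i ∈ Finset.range q, if s(x i, y i) = e then 1 else 0 := by
    refine Finset.sum_congr rfl fun i hi => ?_
    rw [Finset.mem_range] at hi
    rw [hx i hi, hy i hi, Sym2.eq_swap]
  rw [this]
  exact Even.add_self _

/-! ### Cyclic coordinates on H(α_Z, 2q) and its contractions. -/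

/-- The vertex `a_{i1}`, `a_{i2}`, `b_{i1}` or `b_{i2}` of `H(α_Z, 2q)`, with `i` taken cyclically;
the first component of `k` tells `b` from `a`. -/
def zVertex {q : ℕ} (hq : 0 < q) (k : Bool × Fin 2) (i : ℕ) : zShape.CycleVertex q :=
  match k with
  | (false, s) => Sum.inl (⟨i % q, Nat.mod_lt i hq⟩, s)
  | (true, s) => Sum.inr (⟨i % q, Nat.mod_lt i hq⟩, s)

/-- The kind of a vertex of `H(α_Z, 2q)`. -/
def zKind {q : ℕ} : zShape.CycleVertex q → Bool × Fin 2
  | Sum.inl (_, s) => (false, s)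
  | Sum.inr (_, s) => (true, s)

/-- The index of a vertex of `H(α_Z, 2q)`. -/
def zIndex {q : ℕ} : zShape.CycleVertex q → ℕ
  | Sum.inl (i, _) => i
  | Sum.inr (i, _) => i

theorem zIndex_lt {q : ℕ} (u : zShape.CycleVertex q) : zIndex u < q := by
  rcases u with ⟨i, s⟩ | ⟨i, s⟩ <;> exact i.2

theorem zVertex_kind_index {q : ℕ} (hq : 0 < q) (u : zShape.CycleVertex q) :
    zVertex hq (zKind u) (zIndex u) = u := by
  rcases u with ⟨i, s⟩ | ⟨i, s⟩ <;> simp [zVertex, zKind, zIndex, Nat.mod_eq_of_lt i.2]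

theorem zKind_zVertex {q : ℕ} (hq : 0 < q) (k : Bool × Fin 2) (i : ℕ) :
    zKind (zVertex hq k i) = k := by
  rcases k with ⟨_ | _, s⟩ <;> rfl

theorem zIndex_zVertex {q : ℕ} (hq : 0 < q) (k : Bool × Fin 2) (i : ℕ) :
    zIndex (zVertex hq k i) = i % q := by
  rcases k with ⟨_ | _, s⟩ <;> rfl

theorem zVertex_add {q : ℕ} (hq : 0 < q) (k : Bool × Fin 2) (i : ℕ) :
    zVertex hq k (i + q) = zVertex hq k i := by
  rcases k with ⟨_ | _, s⟩ <;> simp [zVertex]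

theorem finRotate_mk_mod {q : ℕ} (hq : 0 < q) (i : ℕ) :
    finRotate q ⟨i % q, Nat.mod_lt i hq⟩ = ⟨(i + 1) % q, Nat.mod_lt _ hq⟩ := by
  cases q with
  | zero => omega
  | succ n =>
    rw [finRotate_apply]
    ext
    simp [Fin.val_add]

/-- The three sums are the first walk, the second walk and the cross edges, grouped as in
`IsEvenZCycle.even`. -/
theorem card_edges_map {q : ℕ} (hq : 0 < q) {β : Type*} [DecidableEq β]
    (g : zShape.CycleVertex q → β) (e : Sym2 β) :
    (Finset.univ.filter fun d : zShape.CycleEdge q =>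
      ((zShape.cycleGraph q).ends d).map g = e).card =
    ∑ i ∈ Finset.range q,
      ((if s(g (zVertex hq (false, 0) i), g (zVertex hq (true, 0) i)) = e then 1 else 0) +
        if s(g (zVertex hq (true, 0) i), g (zVertex hq (false, 0) (i + 1))) = e then 1 else 0) +
    ∑ i ∈ Finset.range q,
      ((if s(g (zVertex hq (false, 1) i), g (zVertex hq (true, 1) i)) = e then 1 else 0) +
        if s(g (zVertex hq (true, 1) i), g (zVertex hq (false, 1) (i + 1))) = e then 1 else 0) +
    ∑ i ∈ Finset.range q,
      ((if s(g (zVertex hq (false, 1) i), g (zVertex hq (true, 0) i)) = e then 1 else 0) +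
        if s(g (zVertex hq (true, 0) i), g (zVertex hq (false, 1) (i + 1))) = e then 1 else 0) := by
  have hedges : ∀ f : Fin 2 × Fin 2 → ℕ, ∑ d : zShape.edges, f d.1 =
      f (0, 0) + (f (1, 0) + f (1, 1)) := by
    intro f
    rw [Finset.sum_coe_sort zShape.edges f]
    change ∑ d ∈ ({(0, 0), (1, 0), (1, 1)} : Finset (Fin 2 × Fin 2)), f d = _
    rw [Finset.sum_insert (by decide), Finset.sum_insert (by decide), Finset.sum_singleton]
  have hsum : ∀ i : Fin q, ∑ b : Bool, ∑ d : zShape.edges,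
      (if ((zShape.cycleGraph q).ends (i, b, d)).map g = e then 1 else 0) =
      (if s(g (zVertex hq (false, 0) i), g (zVertex hq (true, 0) i)) = e then 1 else 0) +
      (if s(g (zVertex hq (true, 0) i), g (zVertex hq (false, 0) (i + 1))) = e then 1 else 0) +
      ((if s(g (zVertex hq (false, 1) i), g (zVertex hq (true, 1) i)) = e then 1 else 0) +
      if s(g (zVertex hq (true, 1) i), g (zVertex hq (false, 1) (i + 1))) = e then 1 else 0) +
      ((if s(g (zVertex hq (false, 1) i), g (zVertex hq (true, 0) i)) = e then 1 else 0) +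
      if s(g (zVertex hq (true, 0) i), g (zVertex hq (false, 1) (i + 1))) = e then 1 else 0) := by
    intro i
    have hi : (⟨(i : ℕ) % q, Nat.mod_lt _ hq⟩ : Fin q) = i := Fin.ext (Nat.mod_eq_of_lt i.2)
    have hrot := finRotate_mk_mod hq i
    rw [hi] at hrot
    rw [Fintype.sum_bool]
    have h1 := hedges fun d => if s(g (zVertex hq (true, d.2) i),
      g (zVertex hq (false, d.1) (i + 1))) = e then 1 else 0
    have h2 := hedges fun d => if s(g (zVertex hq (false, d.1) i),
      g (zVertex hq (true, d.2) i)) = e then 1 else 0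
    have h3 : ∀ d : zShape.edges, ((zShape.cycleGraph q).ends (i, true, d)).map g =
        s(g (zVertex hq (true, d.1.2) i), g (zVertex hq (false, d.1.1) (i + 1))) := by
      intro d
      simp only [BipartiteShape.cycleGraph, zVertex, Sym2.map_mk, hi, hrot]
    have h4 : ∀ d : zShape.edges, ((zShape.cycleGraph q).ends (i, false, d)).map g =
        s(g (zVertex hq (false, d.1.1) i), g (zVertex hq (true, d.1.2) i)) := by
      intro d
      simp only [BipartiteShape.cycleGraph, zVertex, Sym2.map_mk, hi]
    simp only [h3, h4]
    rw [h1, h2]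
    ring
  rw [Finset.card_filter, Fintype.sum_prod_type]
  simp only [Fintype.sum_prod_type, hsum]
  rw [← Finset.sum_add_distrib, ← Finset.sum_add_distrib, Finset.sum_range]

theorem mem_piece_false {q : ℕ} (hq : 0 < q) (k : Bool × Fin 2) (i : ℕ) :
    zVertex hq k i ∈ zShape.piece q ⟨i % q, Nat.mod_lt i hq⟩ false := by
  rcases k with ⟨_ | _, s⟩
  · exact Or.inl ⟨s, rfl⟩
  · exact Or.inr ⟨s, rfl⟩

theorem mem_piece_true_right {q : ℕ} (hq : 0 < q) (s : Fin 2) (i : ℕ) :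
    zVertex hq (true, s) i ∈ zShape.piece q ⟨i % q, Nat.mod_lt i hq⟩ true :=
  Or.inl ⟨s, rfl⟩

theorem mem_piece_true_left {q : ℕ} (hq : 0 < q) (s : Fin 2) (i : ℕ) :
    zVertex hq (false, s) (i + 1) ∈ zShape.piece q ⟨i % q, Nat.mod_lt i hq⟩ true :=
  Or.inr ⟨s, by rw [finRotate_mk_mod hq]; rfl⟩

theorem eq_of_mem_piece {q : ℕ} {i : Fin q} {b : Bool} {u v : zShape.CycleVertex q}
    (hu : u ∈ zShape.piece q i b) (hv : v ∈ zShape.piece q i b) (h : zKind u = zKind v) :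
    u = v := by
  cases b <;> rcases hu with ⟨s, rfl⟩ | ⟨s, rfl⟩ <;> rcases hv with ⟨t, rfl⟩ | ⟨t, rfl⟩ <;>
    first
    | exact absurd (congrArg Prod.fst h) Bool.false_ne_true
    | exact absurd (congrArg Prod.fst h) Bool.false_ne_true.symm
    | rw [show s = t from congrArg Prod.snd h]

/-- The vertices of the contraction, indexed by kind and cyclic position. -/
def contracted {q : ℕ} (hq : 0 < q) (C : ConstraintGraph (zShape.CycleVertex q))
    (k : Bool × Fin 2) (i : ℕ) :
    Quotient C.setoid := Quotient.mk C.setoid (zVertex hq k i)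

theorem contracted_ne {q : ℕ} (hq : 0 < q) {C : ConstraintGraph (zShape.CycleVertex q)}
    (hC : C ∈ zShape.constraintGraphs q) {i : Fin q} {b : Bool}
    {k l : Bool × Fin 2} {m n : ℕ} (hk : zVertex hq k m ∈ zShape.piece q i b)
    (hl : zVertex hq l n ∈ zShape.piece q i b) (hkl : k ≠ l) :
    contracted hq C k m ≠ contracted hq C l n := by
  intro h
  have := hC i b _ hk _ hl (ConstraintGraph.constrained_iff.2 h)
  rw [← zKind_zVertex hq k m, this, zKind_zVertex] at hkl
  exact hkl rfl

theorem contracted_ne_same {q : ℕ} (hq : 0 < q) {C : ConstraintGraph (zShape.CycleVertex q)}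
    (hC : C ∈ zShape.constraintGraphs q) {k l : Bool × Fin 2}
    (hkl : k ≠ l) (i : ℕ) : contracted hq C k i ≠ contracted hq C l i :=
  contracted_ne hq hC (mem_piece_false hq k i) (mem_piece_false hq l i) hkl

theorem contracted_ne_succ {q : ℕ} (hq : 0 < q) {C : ConstraintGraph (zShape.CycleVertex q)}
    (hC : C ∈ zShape.constraintGraphs q) (s t : Fin 2) (i : ℕ) :
    contracted hq C (true, s) i ≠ contracted hq C (false, t) (i + 1) :=
  contracted_ne hq hC (mem_piece_true_right hq s i) (mem_piece_true_left hq t i)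
    fun h => Bool.false_ne_true.symm (congrArg Prod.fst h)

theorem not_isDiag_contract {q : ℕ} (hq : 0 < q) {C : ConstraintGraph (zShape.CycleVertex q)}
    (hC : C ∈ zShape.constraintGraphs q) (d : zShape.CycleEdge q) :
    ¬ (((zShape.cycleGraph q).contract C).ends d).IsDiag := by
  obtain ⟨i, b, e⟩ := d
  have hi : (⟨(i : ℕ) % q, Nat.mod_lt _ hq⟩ : Fin q) = i := Fin.ext (Nat.mod_eq_of_lt i.2)
  have hrot := finRotate_mk_mod hq i
  rw [hi] at hrot
  cases b
  · have := contracted_ne_same hq hC (k := (false, e.1.1)) (l := (true, e.1.2))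
      (fun h => Bool.false_ne_true (congrArg Prod.fst h)) i
    simpa only [contracted, zVertex, hi, Multigraph.contract, BipartiteShape.cycleGraph,
      Sym2.map_mk, Sym2.mk_isDiag_iff] using this
  · have := contracted_ne_succ hq hC e.1.2 e.1.1 i
    simpa only [contracted, zVertex, hi, hrot, Multigraph.contract, BipartiteShape.cycleGraph,
      Sym2.map_mk, Sym2.mk_isDiag_iff] using this

open Classical in
theorem isEvenZCycle_of_value_ne_zero {q : ℕ} (hq : 0 < q) {C : ConstraintGraph
    (zShape.CycleVertex q)}
    (hC : C ∈ zShape.constraintGraphs q)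
    (hv : C.value (zShape.cycleGraph q) ≠ 0) :
    IsEvenZCycle q (contracted hq C (false, 0)) (contracted hq C (true, 0))
      (contracted hq C (false, 1)) (contracted hq C (true, 1)) where
  pos := hq
  per_x i := by rw [contracted, zVertex_add, contracted]
  per_y i := by rw [contracted, zVertex_add, contracted]
  per_z i := by rw [contracted, zVertex_add, contracted]
  per_w i := by rw [contracted, zVertex_add, contracted]
  xz i := contracted_ne_same hq hC (by simp) i
  yw i := contracted_ne_same hq hC (by simp) i
  xy i := contracted_ne_same hq hC (by simp) i
  yx i := contracted_ne_succ hq hC _ _ i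
  zw i := contracted_ne_same hq hC (by simp) i
  wz i := contracted_ne_succ hq hC _ _ i
  surj b := by
    induction b using Quotient.ind with | _ u =>
    refine ⟨zIndex u, ?_⟩
    have hu : Quotient.mk C.setoid u = contracted hq C (zKind u) (zIndex u) := by
      rw [contracted, zVertex_kind_index]
    rw [hu]
    obtain ⟨b, s⟩ := zKind u
    fin_cases b <;> fin_cases s <;> simp
  even e := (congrArg Even (card_edges_map hq (Quotient.mk C.setoid) e)).mp
      ((ConstraintGraph.value_ne_zero_iff _ C (not_isDiag_contract hq hC)).1 hv e)

/-! ### Dominant constraint graphs and pairs of noncrossing partitions. -/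

open BipartiteShape

/-- The relation on the positions of the vertices of kind `k` that belongs to a pair `p` of
noncrossing partitions: the Kreweras complement on the vertices `b_{ix}`. -/
def pairRel (p : Setoid ℕ × Setoid ℕ) (k : Bool × Fin 2) : Setoid ℕ :=
  if k.1 then kreweras (if k.2 = 0 then p.1 else p.2) else if k.2 = 0 then p.1 else p.2

/-- The equivalence relation on the vertices of `H(α_Z, 2q)` that belongs to a pair of
noncrossing partitions. -/
def pairSetoid (q : ℕ) (p : Setoid ℕ × Setoid ℕ) : Setoid (zShape.CycleVertex q) where
  r u v := zKind u = zKind v ∧ pairRel p (zKind u) (zIndex u) (zIndex v)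
  iseqv := by
    refine ⟨fun u => ⟨rfl, (pairRel p _).refl _⟩, fun {u v} h => ⟨h.1.symm, ?_⟩,
      fun {u v w} h h' => ⟨h.1.trans h'.1, ?_⟩⟩
    · rw [← h.1]
      exact (pairRel p _).symm h.2
    · have := h'.2
      rw [← h.1] at this
      exact (pairRel p _).trans h.2 this

theorem pairSetoid_apply {q : ℕ} {p : Setoid ℕ × Setoid ℕ} {u v : zShape.CycleVertex q} :
    pairSetoid q p u v ↔ zKind u = zKind v ∧ pairRel p (zKind u) (zIndex u) (zIndex v) := Iff.rfl

section

variable {q : ℕ} {C : ConstraintGraph (zShape.CycleVertex q)}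
  {p : Setoid ℕ × Setoid ℕ}

theorem contracted_eq_iff (hq : 0 < q) (h : ∀ u v, C.Constrained u v ↔ pairSetoid q p u v)
    {k l : Bool × Fin 2}
    {i j : ℕ} : contracted hq C k i = contracted hq C l j ↔
      k = l ∧ pairRel p k (i % q) (j % q) := by
  rw [contracted, contracted, ← ConstraintGraph.constrained_iff, h, pairSetoid_apply,
    zKind_zVertex, zKind_zVertex, zIndex_zVertex, zIndex_zVertex]

theorem mem_constraintGraphs_of_pair
    (h : ∀ u v, C.Constrained u v ↔ pairSetoid q p u v) :
    C ∈ zShape.constraintGraphs q := fun _ _ u hu v hv huv =>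
  eq_of_mem_piece hu hv ((h u v).1 huv).1

-- Each walk is retraced through the cyclic successor of its own partition. For the cross edges `ν`,
-- taken from `p.1`, serves again: it respects the classes of the z_i because `p.1 ≤ p.2`.
open Classical in
theorem value_ne_zero_of_pair (hq : 0 < q) (hp : p ∈ noncrossingPairs 0 q)
    (h : ∀ u v, C.Constrained u v ↔ pairSetoid q p u v) : C.value (zShape.cycleGraph q) ≠ 0 := by
  obtain ⟨h1, h2, hle⟩ := hp
  obtain ⟨ν, hν, hinj, hret⟩ := h1.exists_retrace
  obtain ⟨μ, hμ, hinj', hret'⟩ := h2.exists_retrace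
  have hmod : ∀ {i}, i < q → i % q = i := fun hi => Nat.mod_eq_of_lt hi
  rw [ConstraintGraph.value_ne_zero_iff _ C
    (not_isDiag_contract hq (mem_constraintGraphs_of_pair h))]
  intro e
  refine (congrArg Even (card_edges_map hq (Quotient.mk C.setoid) e)).mpr ?_
  refine ((even_sum_of_retrace (x := contracted hq C (false, 0)) (y := contracted hq C (true, 0))
    hν hinj ?_ ?_ e).add (even_sum_of_retrace (x := contracted hq C (false, 1))
    (y := contracted hq C (true, 1)) hμ hinj' ?_ ?_ e)).add
    (even_sum_of_retrace (x := contracted hq C (false, 1)) (y := contracted hq C (true, 0))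
    hν hinj ?_ ?_ e)
  all_goals
    intro i hi
    rw [contracted_eq_iff hq h, hmod hi]
    refine ⟨rfl, ?_⟩
  · exact (hret i hi).2
  · rw [hmod (hν i hi)]
    exact (hret i hi).1
  · exact (hret' i hi).2
  · rw [hmod (hμ i hi)]
    exact (hret' i hi).1
  · exact hle (hret i hi).2
  · rw [hmod (hν i hi)]
    exact (hret i hi).1

/-- Each partition and its complement have at least `q + 1` classes by `card_first_add_card_last`,
and different kinds are never related. -/
theorem le_card_of_pair (hq : 0 < q) (h : ∀ u v, C.Constrained u v ↔ pairSetoid q p u v) :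
    2 * q + 2 ≤ Nat.card (Quotient C.setoid) := by
  classical
  have : Finite (Quotient C.setoid) := Quotient.finite _
  cases nonempty_fintype (Quotient C.setoid)
  have hmod : ∀ {i}, i < q → i % q = i := fun hi => Nat.mod_eq_of_lt hi
  obtain ⟨F₁, L₁, hF₁, hL₁, hc₁, hf₁, hl₁⟩ := card_first_add_card_last p.1 hq
  obtain ⟨F₂, L₂, hF₂, hL₂, hc₂, hf₂, hl₂⟩ := card_first_add_card_last p.2 hq
  set I : Bool × Fin 2 → Finset ℕ := fun k =>
    if k.1 then (if k.2 = 0 then L₁ else L₂) else if k.2 = 0 then F₁ else F₂ with hI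
  have hIlt : ∀ k, ∀ i ∈ I k, i < q := by
    rintro ⟨b, s⟩ i hi
    rw [← Finset.mem_range]
    cases b <;> simp only [hI, Bool.false_eq_true, if_true, if_false] at hi <;> split_ifs at hi
    exacts [hF₁ hi, hF₂ hi, hL₁ hi, hL₂ hi]
  have hIinj : ∀ k, ∀ i ∈ I k, ∀ j ∈ I k, pairRel p k i j → i = j := by
    rintro ⟨b, s⟩
    have hs : s = 0 ∨ s = 1 := by omega
    cases b <;> rcases hs with rfl | rfl
    exacts [hf₁, hf₂, hl₁, hl₂]
  have hcard : ((Finset.univ : Finset (Bool × Fin 2)).sigma I).card ≤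
      Fintype.card (Quotient C.setoid) := by
    rw [← Finset.card_univ]
    refine Finset.card_le_card_of_injOn (fun s => contracted hq C s.1 s.2)
      (fun _ _ => Finset.mem_coe.2 (Finset.mem_univ _)) ?_
    rintro ⟨k, i⟩ hi ⟨l, j⟩ hj hij
    rw [Finset.mem_coe, Finset.mem_sigma] at hi hj
    obtain ⟨rfl, hr⟩ := (contracted_eq_iff hq h).1 hij
    rw [hmod (hIlt _ _ hi.2), hmod (hIlt _ _ hj.2)] at hr
    rw [show i = j from hIinj k i hi.2 j hj.2 hr]
  rw [Finset.card_sigma, Fintype.sum_prod_type, Fintype.sum_bool, Fin.sum_univ_two,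
    Fin.sum_univ_two] at hcard
  simp only [hI, Bool.false_eq_true, if_true, if_false, one_ne_zero] at hcard
  rw [Nat.card_eq_fintype_card]
  omega

theorem card_le_of_value_ne_zero (hq : 0 < q) (hC : C ∈ zShape.constraintGraphs q)
    (hv : C.value (zShape.cycleGraph q) ≠ 0) : Nat.card (Quotient C.setoid) ≤ 2 * q + 2 := by
  classical
  have : Finite (Quotient C.setoid) := Quotient.finite _
  cases nonempty_fintype (Quotient C.setoid)
  rw [Nat.card_eq_fintype_card]
  exact (isEvenZCycle_of_value_ne_zero hq hC hv).card_le

/-- The dominant constraint graphs are those whose contraction has `2q + 2` vertices. -/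
theorem isDominant_iff (hq : 0 < q) : zShape.IsDominant q C ↔ C ∈ zShape.constraintGraphs q ∧
    C.value (zShape.cycleGraph q) ≠ 0 ∧ Nat.card (Quotient C.setoid) = 2 * q + 2 := by
  have hsum := fun D : ConstraintGraph (zShape.CycleVertex q) => D.numEdges_add_card
  constructor
  · rintro ⟨hC, hv, hmin⟩
    refine ⟨hC, hv, le_antisymm (card_le_of_value_ne_zero hq hC hv) ?_⟩
    -- The pair of discrete partitions attains the bound, so a minimal `C` must attain it too.
    have hmem : ((⊥, ⊥) : Setoid ℕ × Setoid ℕ) ∈ noncrossingPairs 0 q := by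
      have hbot : IsNoncrossing 0 q ⊥ :=
        ⟨fun i j h => Or.inl h, fun i j k l hij hjk _ hik _ => by
          have : i = k := hik
          omega⟩
      exact ⟨hbot, hbot, le_rfl⟩
    obtain ⟨D, hD⟩ := ConstraintGraph.exists_constrained_iff
      (pairSetoid q ((⊥, ⊥) : Setoid ℕ × Setoid ℕ))
    have h1 := hmin D (mem_constraintGraphs_of_pair hD) (value_ne_zero_of_pair hq hmem hD)
    have h2 := le_card_of_pair hq hD
    have h3 := hsum C
    have h4 := hsum D
    omega
  · rintro ⟨hC, hv, hcard⟩
    refine ⟨hC, hv, fun D hD hDv => ?_⟩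
    have h2 := card_le_of_value_ne_zero hq hD hDv
    have h3 := hsum C
    have h4 := hsum D
    omega

/-- The partitions of the vertices `a_{i1}` and of the vertices `a_{i2}` by a constraint graph. -/
def leftPair (hq : 0 < q) (C : ConstraintGraph (zShape.CycleVertex q)) : Setoid ℕ × Setoid ℕ :=
  (restrictInterval 0 q (Setoid.ker (contracted hq C (false, 0))),
    restrictInterval 0 q (Setoid.ker (contracted hq C (false, 1))))

theorem restrictInterval_ker {β : Type*} {f : ℕ → β} {i j : ℕ} (hi : i < q) (hj : j < q) :
    restrictInterval 0 q (Setoid.ker f) i j ↔ f i = f j := by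
  rw [restrictInterval_apply, Setoid.ker_def]
  constructor
  · rintro (rfl | h)
    · rfl
    · exact h.2.2.2.2
  · exact fun h => Or.inr ⟨Nat.zero_le _, hi, Nat.zero_le _, hj, h⟩

theorem isNoncrossing_of_isTreeWalk {β : Type*} [DecidableEq β] {x y : ℕ → β}
    (h : IsTreeWalk q (interleave x y)) :
    IsNoncrossing 0 q (restrictInterval 0 q (Setoid.ker x)) where
  supp i j hij := by
    rcases hij with hij | ⟨h1, h2, h3, h4, -⟩
    · exact Or.inl hij
    · exact Or.inr ⟨h1, h2, h3, h4⟩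
  nc i j k l hij hjk hkl hik hjl := by
    have hl : l < q := by
      rcases hjl with hjl | hjl
      · omega
      · exact hjl.2.2.2.1
    rw [restrictInterval_ker (by omega) (by omega)] at hik hjl ⊢
    have := h.noncrossing hij hjk hkl hl
    simp only [interleave_two_mul] at this
    exact this hik hjl

theorem eq_iff_kreweras_of_isTreeWalk {β : Type*} [DecidableEq β] {x y : ℕ → β}
    (h : IsTreeWalk q (interleave x y)) {i j : ℕ} (hi : i < q) (hj : j < q) :
    y i = y j ↔ kreweras (restrictInterval 0 q (Setoid.ker x)) i j := by
  have key : ∀ i j, i ≤ j → j < q →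
      (y i = y j ↔ kreweras (restrictInterval 0 q (Setoid.ker x)) i j) := by
    intro i j hij hj
    have := h.odd_eq_iff hij hj
    simp only [interleave_two_mul, interleave_two_mul_add_one] at this
    rw [this, kreweras_iff_of_le hij]
    constructor
    · rintro hsat a b (rfl | ⟨-, ha, -, hb, hab⟩) hia
      · exact hia
      · exact hsat a ha b hb hab hia
    · intro hsat a ha b hb hab
      exact hsat a b ((restrictInterval_ker ha hb).2 hab)
  rcases le_total i j with hij | hij
  · exact key i j hij hj
  · rw [eq_comm, key j i hij hi]
    exact ⟨fun h => Setoid.symm' _ h, fun h => Setoid.symm' _ h⟩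

/-- Vertices of different kinds stay apart, because the two walks are disjoint and within a tree
walk even and odd positions differ. Within a kind, the tree walks give the partition or its Kreweras
complement. -/
theorem leftPair_mem_and_constrained_iff (hq : 0 < q) (hC : zShape.IsDominant q C) :
    leftPair hq C ∈ noncrossingPairs 0 q ∧
      ∀ u v, C.Constrained u v ↔ pairSetoid q (leftPair hq C) u v := by
  classical
  have : Finite (Quotient C.setoid) := Quotient.finite _
  cases nonempty_fintype (Quotient C.setoid)
  obtain ⟨hmem, hv, hcard⟩ := (isDominant_iff hq).1 hC
  rw [Nat.card_eq_fintype_card] at hcard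
  obtain ⟨hT, hT', hdisj, hle⟩ :=
    (isEvenZCycle_of_value_ne_zero hq hmem hv).structure_of_card_eq hcard
  constructor
  · refine ⟨isNoncrossing_of_isTreeWalk hT, isNoncrossing_of_isTreeWalk hT', ?_⟩
    rintro i j (rfl | ⟨h1, h2, h3, h4, h5⟩)
    · exact Setoid.refl' _ _
    · refine Or.inr ⟨h1, h2, h3, h4, ?_⟩
      rw [Setoid.ker_def] at h5 ⊢
      rcases le_total i j with h | h
      · exact hle i j h h4 h5
      · exact (hle j i h h2 h5.symm).symm
  · have hxy : ∀ s : Fin 2, ∀ i < q, ∀ j < q,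
        contracted hq C (false, s) i ≠ contracted hq C (true, s) j := by
      intro s i hi j hj
      fin_cases s
      · have := hT.even_ne_odd hi hj
        rwa [interleave_two_mul, interleave_two_mul_add_one] at this
      · have := hT'.even_ne_odd hi hj
        rwa [interleave_two_mul, interleave_two_mul_add_one] at this
    have hrow : ∀ b c : Bool, ∀ i < q, ∀ j < q,
        contracted hq C (b, 0) i ≠ contracted hq C (c, 1) j := by
      have hpos : ∀ (b : Bool) (s : Fin 2), ∀ i < q, ∃ n < 2 * q, contracted hq C (b, s) i =
          interleave (contracted hq C (false, s)) (contracted hq C (true, s)) n := by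
        intro b s i hi
        cases b
        · exact ⟨2 * i, by omega, (interleave_two_mul _ _ i).symm⟩
        · exact ⟨2 * i + 1, by omega, (interleave_two_mul_add_one _ _ i).symm⟩
      intro b c i hi j hj
      obtain ⟨m, hm, hm'⟩ := hpos b 0 i hi
      obtain ⟨n, hn, hn'⟩ := hpos c 1 j hj
      rw [hm', hn']
      exact hdisj m hm n hn
    have hkind : ∀ k l : Bool × Fin 2, ∀ i < q, ∀ j < q,
        contracted hq C k i = contracted hq C l j → k = l := by
      rintro ⟨b, s⟩ ⟨c, t⟩ i hi j hj he
      obtain rfl : s = t := by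
        by_contra hst
        have : (s = 0 ∧ t = 1) ∨ (s = 1 ∧ t = 0) := by omega
        rcases this with ⟨rfl, rfl⟩ | ⟨rfl, rfl⟩
        · exact hrow b c i hi j hj he
        · exact hrow c b j hj i hi he.symm
      cases b <;> cases c
      · rfl
      · exact absurd he (hxy s i hi j hj)
      · exact absurd he.symm (hxy s j hj i hi)
      · rfl
    have hrel : ∀ k : Bool × Fin 2, ∀ i < q, ∀ j < q,
        (contracted hq C k i = contracted hq C k j ↔ pairRel (leftPair hq C) k i j) := by
      rintro ⟨b, s⟩ i hi j hj
      have hs : s = 0 ∨ s = 1 := by omega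
      cases b <;> rcases hs with rfl | rfl
      · exact (restrictInterval_ker hi hj).symm
      · exact (restrictInterval_ker hi hj).symm
      · exact eq_iff_kreweras_of_isTreeWalk hT hi hj
      · exact eq_iff_kreweras_of_isTreeWalk hT' hi hj
    intro u v
    have hu := zIndex_lt u
    have hv' := zIndex_lt v
    have hmk : ∀ u, Quotient.mk C.setoid u = contracted hq C (zKind u) (zIndex u) := fun u => by
      rw [contracted, zVertex_kind_index]
    rw [ConstraintGraph.constrained_iff, hmk, hmk, pairSetoid_apply]
    constructor
    · intro he
      have hk := hkind _ _ _ hu _ hv' he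
      rw [← hk] at he
      exact ⟨hk, (hrel _ _ hu _ hv').1 he⟩
    · rintro ⟨hk, hr⟩
      rw [← hk]
      exact (hrel _ _ hu _ hv').2 hr

theorem leftPair_eq_of_constrained_iff (hq : 0 < q) (hp : p ∈ noncrossingPairs 0 q)
    (h : ∀ u v, C.Constrained u v ↔ pairSetoid q p u v) : leftPair hq C = p := by
  have hmod : ∀ {i}, i < q → i % q = i := fun hi => Nat.mod_eq_of_lt hi
  have key : ∀ (s : Fin 2) (r : Setoid ℕ), IsNoncrossing 0 q r → pairRel p (false, s) = r →
      restrictInterval 0 q (Setoid.ker (contracted hq C (false, s))) = r := by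
    intro s r hr hs
    ext i j
    constructor
    · rintro (rfl | ⟨-, hi, -, hj, hij⟩)
      · exact r.refl _
      · rw [Setoid.ker_def, contracted_eq_iff hq h, hmod hi, hmod hj, hs] at hij
        exact hij.2
    · intro hij
      rcases hr.supp _ _ hij with rfl | ⟨h1, h2, h3, h4⟩
      · exact Setoid.refl' _ _
      · refine Or.inr ⟨h1, h2, h3, h4, ?_⟩
        rw [Setoid.ker_def, contracted_eq_iff hq h, hmod h2, hmod h4, hs]
        exact ⟨rfl, hij⟩
  exact Prod.ext (key 0 _ hp.1 rfl) (key 1 _ hp.2.1 rfl)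

/-- The map `leftPair` is injective because the pair recovers `Constrained`, and surjective because
every pair gives a graph attaining the bound. -/
theorem card_isDominant (hq : 0 < q) :
    Nat.card {C : ConstraintGraph (zShape.CycleVertex q) // zShape.IsDominant q C} =
      ternaryCount q := by
  have hcard : Nat.card (noncrossingPairs 0 q) = ternaryCount q := by
    have := encard_noncrossingPairs q 0
    rw [zero_add] at this
    rw [Nat.card_coe_set_eq, Set.ncard, this, ENat.toNat_natCast]
  rw [← hcard]
  refine Nat.card_congr (Equiv.ofBijective
    (fun C => ⟨leftPair hq C.1, (leftPair_mem_and_constrained_iff hq C.2).1⟩) ⟨?_, ?_⟩)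
  · rintro ⟨C, hC⟩ ⟨D, hD⟩ hCD
    have he : leftPair hq C = leftPair hq D := congrArg Subtype.val hCD
    have h1 := (leftPair_mem_and_constrained_iff hq hC).2
    have h2 := (leftPair_mem_and_constrained_iff hq hD).2
    rw [← he] at h2
    exact Subtype.ext (ConstraintGraph.ext_constrained fun u v => (h1 u v).trans (h2 u v).symm)
  · rintro ⟨p, hp⟩
    obtain ⟨C, hC⟩ := ConstraintGraph.exists_constrained_iff (pairSetoid q p)
    have hdom : zShape.IsDominant q C := by
      have h1 := mem_constraintGraphs_of_pair hC
      have h2 := value_ne_zero_of_pair hq hp hC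
      exact (isDominant_iff hq).2 ⟨h1, h2,
        le_antisymm (card_le_of_value_ne_zero hq h1 h2) (le_card_of_pair hq hC)⟩
    exact ⟨⟨C, hdom⟩, Subtype.ext (leftPair_eq_of_constrained_iff hq hp hC)⟩

end

/-! ### The empty multigraph, and the conclusion. -/

/-- Positions modulo `q` require `0 < q`; for `q = 0` there is a single constraint graph, and its
value is an empty product. -/
theorem card_isDominant_zero :
    Nat.card {C : ConstraintGraph (zShape.CycleVertex 0) // zShape.IsDominant 0 C} = 1 := by
  classical
  have hV : IsEmpty (zShape.CycleVertex 0) := ⟨fun u => Nat.not_lt_zero _ (zIndex_lt u)⟩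
  have hE : IsEmpty (zShape.CycleEdge 0) := ⟨fun e => Nat.not_lt_zero _ e.1.2⟩
  have hsub : ∀ C D : ConstraintGraph (zShape.CycleVertex 0), C = D := fun C D =>
    ConstraintGraph.ext_constrained fun u => hV.elim u
  have hdom : ∀ C : ConstraintGraph (zShape.CycleVertex 0), zShape.IsDominant 0 C := by
    intro C
    refine ⟨fun i => i.elim0, ?_, fun D _ _ => by rw [hsub C D]⟩
    rw [ConstraintGraph.value_ne_zero_iff _ C fun e => hE.elim e]
    intro f
    rw [Finset.univ_eq_empty, Finset.filter_empty, Finset.card_empty]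
    exact Even.zero
  obtain ⟨C, -⟩ := ConstraintGraph.exists_constrained_iff (⊥ : Setoid (zShape.CycleVertex 0))
  rw [Nat.card_eq_one_iff_exists]
  exact ⟨⟨C, hdom C⟩, fun D => Subtype.ext (hsub _ _)⟩

end GraphMatrix

theorem mainTheorem1 (q : ℕ) :
    (Nat.card {C : GraphMatrix.ConstraintGraph (GraphMatrix.zShape.CycleVertex q) //
        GraphMatrix.zShape.IsDominant q C} : ℚ) =
      1 / (2 * (q : ℚ) + 1) * ((3 * q).choose q : ℚ) := by
  have hcard : Nat.card {C : GraphMatrix.ConstraintGraph (GraphMatrix.zShape.CycleVertex q) //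
      GraphMatrix.zShape.IsDominant q C} = GraphMatrix.ternaryCount q := by
    rcases Nat.eq_zero_or_pos q with rfl | hq
    · rw [GraphMatrix.card_isDominant_zero, GraphMatrix.ternaryCount]
    · exact GraphMatrix.card_isDominant hq
  have hformula := GraphMatrix.ternaryCount_formula q
  have hne : (2 * (q : ℚ) + 1) ≠ 0 := by positivity
  rw [hcard, ← hformula]
  push_cast
  field_simp
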